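/- For $g\in L^2(\mathbb R)$ and $x,\omega\in\mathbb R$ write $g_{x,\omega}(t)=e^{2\pi i\omega t}g(t-x)$. Let $a,b>0$ and let $(g,a,b)$ generate a Gabor frame for $L^2(\mathbb R)$ with frame bounds $A,B>0$, i.e. $A\|f\|^2\le\sum_{n,m\in\mathbb Z}|\langle f,g_{na,mb}\rangle|^2\le B\|f\|^2$ for all $f\in L^2(\mathbb R)$. Let $\gamma=S^{-1}g$ be the canonical dual window, where $Sf=\sum_{n,m\in\mathbb Z}\langle f,g_{na,mb}\rangle g_{na,mb}$ is the frame operator. For $n=0,1,2,\dots$ let $$\gamma^{(n)}=\sum_{|k|,|l|\le n}c^{(n)}_{k,l}\,g_{k/b,l/a},\qquad c^{(n)}=G_n^{-1}\sigma^{(n)},$$ where $G_n=\big(\langle g_{k'/b,l'/a},g_{k/b,l/a}\rangle\big)_{|k|,|l|\le n;\,|k'|,|l'|\le n}$ (with row index $(k,l)$ and column index $(k',l')$) and $\sigma^{(n)}=(ab\,\delta_{k0}\delta_{l0})_{|k|,|l|\le n}$. Theorem. Suppose that there are $\lambda,C,D>0$ such that $$|g(t)|\le Ce^{-\lambda|t|}\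 \text{ for almost every } t\in\mathbb R,\qquad |\hat g(\omega)|\le De^{-\lambda|\omega|}\ \text{ for every } \omega\in\mathbb R,$$ where $\hat g(\omega)=\int_{\mathbb R}g(t)e^{-2\pi it\omega}\,dt$. Then there exist $\lambda'$ with $0<\lambda'<\lambda$ and a constant $C'$, depending only on the frame bounds $A,B$ and on $\lambda'$, such that $$\|\gamma-\gamma^{(n)}\|_{L^2(\mathbb R)}\le C'e^{-\lambda' n}\qquad\text{for all } n=0,1,2,\dots.$$ -/

import Mathlib

open MeasureTheory
open scoped FourierTransform

noncomputable section

/-- The Hilbert space `L²(ℝ)` of complex-valued functions. Mathlib's `inner ℂ x y` is linear in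
`y`, so the pairing `⟨f, h⟩` that is linear in `f` is written `inner ℂ h f` below. -/
abbrev L2R : Type := Lp ℂ 2 (volume : Measure ℝ)

theorem memLp_timeFreqShift (x ω : ℝ) (f : L2R) :
    MemLp (fun t : ℝ => Complex.exp (2 * Real.pi * Complex.I * (ω * t : ℝ)) * f (t - x)) 2
      (volume : Measure ℝ) := by
  have h1 : MemLp (fun t : ℝ => f (t - x)) 2 (volume : Measure ℝ) :=
    (Lp.memLp f).comp_measurePreserving (measurePreserving_sub_right volume x)
  have h2 : AEStronglyMeasurable
      (fun t : ℝ => Complex.exp (2 * Real.pi * Complex.I * (ω * t : ℝ))) volume :=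
    Continuous.aestronglyMeasurable (by fun_prop)
  refine h1.of_le (h2.mul h1.1) (Filter.Eventually.of_forall fun t => ?_)
  have h3 : ‖Complex.exp (2 * Real.pi * Complex.I * (ω * t : ℝ))‖ = 1 := by
    have h4 : (2 * Real.pi * Complex.I * (ω * t : ℝ) : ℂ)
        = ((2 * Real.pi * (ω * t) : ℝ) : ℂ) * Complex.I := by
      push_cast
      ring
    rw [h4, Complex.norm_exp_ofReal_mul_I]
  rw [norm_mul, h3, one_mul]

/-- The time-frequency shift `t ↦ e^{2πiωt} f(t - x)` of `f ∈ L²(ℝ)`. -/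
def timeFreqShift (x ω : ℝ) (f : L2R) : L2R := (memLp_timeFreqShift x ω f).toLp

/-- The element `g_{na,mb}` of the Gabor system, for the index `p = (n, m)`. -/
def gaborAtom (g : L2R) (a b : ℝ) (p : ℤ × ℤ) : L2R := timeFreqShift (p.1 * a) (p.2 * b) g

/-- `(g, a, b)` generates a Gabor frame for `L²(ℝ)` with frame bounds `A, B > 0`. -/
def IsGaborFrame (g : L2R) (a b A B : ℝ) : Prop :=
  0 < A ∧ 0 < B ∧ ∀ f : L2R,
    Summable (fun p : ℤ × ℤ => ‖inner ℂ (gaborAtom g a b p) f‖ ^ 2) ∧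
    A * ‖f‖ ^ 2 ≤ ∑' p : ℤ × ℤ, ‖inner ℂ (gaborAtom g a b p) f‖ ^ 2 ∧
    ∑' p : ℤ × ℤ, ‖inner ℂ (gaborAtom g a b p) f‖ ^ 2 ≤ B * ‖f‖ ^ 2

/-- The Gabor frame operator `S f = ∑ ⟨f, g_{na,mb}⟩ g_{na,mb}`. -/
def gaborFrameOp (g : L2R) (a b : ℝ) (f : L2R) : L2R :=
  ∑' p : ℤ × ℤ, inner ℂ (gaborAtom g a b p) f • gaborAtom g a b p

/-- The canonical dual window `γ = S⁻¹ g` (for a Gabor frame, `S` is a bijection of `L²(ℝ)`). -/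
def gaborDualWindow (g : L2R) (a b : ℝ) : L2R := Function.invFun (gaborFrameOp g a b) g

/-- The element `g_{k/b,l/a}` of the Gabor system on the adjoint lattice, for the index
`p = (k, l)`. -/
def adjointAtom (g : L2R) (a b : ℝ) (p : ℤ × ℤ) : L2R := timeFreqShift (p.1 / b) (p.2 / a) g

/-- The indices `(k, l)` with `max (|k|, |l|) ≤ n`. -/
abbrev sectionIndex (n : ℕ) : Finset (ℤ × ℤ) :=
  Finset.Icc (-(n : ℤ)) n ×ˢ Finset.Icc (-(n : ℤ)) n

/-- The finite section `H_n H_n^*` of the Gram matrix of the system `g_{k/b,l/a}`; its entry in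
row `(k, l)` and column `(k', l')` is `⟨g_{k'/b,l'/a}, g_{k/b,l/a}⟩`. -/
def gramSection (g : L2R) (a b : ℝ) (n : ℕ) :
    Matrix (sectionIndex n) (sectionIndex n) ℂ :=
  fun p q => inner ℂ (adjointAtom g a b p) (adjointAtom g a b q)

/-- The vector `σ^{(n)}`, with `(k, l)` entry `ab δ_{k0} δ_{l0}` for `|k|, |l| ≤ n`. -/
def sigmaSection (a b : ℝ) (n : ℕ) : sectionIndex n → ℂ :=
  fun p => if (p : ℤ × ℤ) = (0, 0) then ((a * b : ℝ) : ℂ) else 0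

/-- The operator `H_n^*`, `c ↦ ∑_{|k|,|l| ≤ n} c_{k,l} g_{k/b,l/a}`. -/
def sectionSynthesis (g : L2R) (a b : ℝ) (n : ℕ) (c : sectionIndex n → ℂ) : L2R :=
  ∑ p : sectionIndex n, c p • adjointAtom g a b p

/-- The finite-section approximation `γ^{(n)} = H_n^* (H_n H_n^*)⁻¹ σ^{(n)}` of the dual window
(for a Gabor frame with `a, b > 0`, the matrix `H_n H_n^*` is invertible). -/
def dualWindowSection (g : L2R) (a b : ℝ) (n : ℕ) : L2R :=
  sectionSynthesis g a b n (Matrix.mulVec (gramSection g a b n)⁻¹ (sigmaSection a b n))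

end

/-! The argument moves the problem to the adjoint lattice. Moyal's formula identifies the Fourier
coefficients of the periodized correlation θ ↦ ∑ ⟨f_θ, g_n⟩⟨γ_n, h_θ⟩ as products of inner products
over that lattice (`integral_periodizedCorrelation`). For a dual pair the correlation is constant,
which gives the Wexler-Raz biorthogonality (`inner_adjointAtom_of_dual`). For γ = g the series
converges absolutely, which gives Janssen's representation of S (`hasSum_inner_frameOp`), so S acts
on the adjoint atoms as a twisted convolution.

Biorthogonality says that c⁽ⁿ⁾ solves the normal equations of γ. So γ⁽ⁿ⁾ is the orthogonal
projection of γ onto the span of the atoms in the section, and the error is ‖Qγ‖, with Q the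
projection onto the orthogonal complement.

To bound ‖Qγ‖, let T = 1 - tS with t = A/B², a contraction of ratio q < 1, and write γ = ∑_{k<K}
T^k(tg) + T^K γ. Decay of g and ĝ makes the convolution coefficients of S summable against
e^{s(|k|+|l|)}. Q kills the atoms in the section, so its norm on the atom at (k,l) is at most ‖g‖
e^{s(|k|+|l|)} e^{-sn}, and each T enlarges such a bound by a fixed factor (`norm_iterate_le`).
Hence ‖Qγ‖ ≤ t‖g‖ M^K e^{-sn} + ‖γ‖ q^K, and K proportional to n gives exponential decay.

The constant so obtained depends on g. Since also ‖Qγ‖ ≤ ‖γ‖ ≤ A^{-1/2}, lowering the rate replaces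
it by 2A^{-1/2} (`exists_rate_of_bound`). -/

namespace Gabor

open Complex Filter Topology ComplexConjugate

/-! ### Phases -/

/-- The phase `e^{2πiθ}`. -/
noncomputable def phase (θ : ℝ) : ℂ := Complex.exp (2 * Real.pi * Complex.I * (θ : ℝ))

theorem phase_eq (θ : ℝ) : phase θ = Complex.exp (((2 * Real.pi * θ : ℝ) : ℂ) * Complex.I) := by
  unfold phase; congr 1; push_cast; ring

theorem norm_phase (θ : ℝ) : ‖phase θ‖ = 1 := by
  rw [phase_eq, Complex.norm_exp_ofReal_mul_I]

theorem phase_add (s t : ℝ) : phase (s + t) = phase s * phase t := by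
  unfold phase; rw [← Complex.exp_add]; congr 1; push_cast; ring

@[simp] theorem phase_zero : phase 0 = 1 := by simp [phase]

theorem conj_phase (θ : ℝ) : conj (phase θ) = phase (-θ) := by
  rw [phase_eq, phase_eq, ← Complex.exp_conj]
  congr 1
  rw [map_mul, Complex.conj_ofReal, Complex.conj_I]
  push_cast
  ring

theorem phase_neg_mul_self (θ : ℝ) : phase (-θ) * phase θ = 1 := by
  rw [← phase_add]; simp

theorem phase_self_mul_neg (θ : ℝ) : phase θ * phase (-θ) = 1 := by
  rw [← phase_add]; simp

@[simp] theorem phase_intCast (n : ℤ) : phase n = 1 := by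
  unfold phase
  rw [Complex.exp_eq_one_iff]
  exact ⟨n, by push_cast; ring⟩

theorem phase_add_intCast (θ : ℝ) (n : ℤ) : phase (θ + n) = phase θ := by
  rw [phase_add, phase_intCast, mul_one]

theorem continuous_phase : Continuous phase := by unfold phase; fun_prop

/-! ### Time-frequency shifts -/

theorem timeFreqShift_coe (x ω : ℝ) (f : L2R) :
    timeFreqShift x ω f =ᵐ[volume] fun t => phase (ω * t) * f (t - x) :=
  MemLp.coeFn_toLp _

theorem ae_comp_sub_right {p : ℝ → Prop} (h : ∀ᵐ t, p t) (x : ℝ) : ∀ᵐ t : ℝ, p (t - x) :=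
  (measurePreserving_sub_right volume x).quasiMeasurePreserving.ae h

theorem timeFreqShift_add (x ω : ℝ) (f h : L2R) :
    timeFreqShift x ω (f + h) = timeFreqShift x ω f + timeFreqShift x ω h := by
  apply Lp.ext
  filter_upwards [timeFreqShift_coe x ω (f + h), timeFreqShift_coe x ω f, timeFreqShift_coe x ω h,
    Lp.coeFn_add (timeFreqShift x ω f) (timeFreqShift x ω h),
    ae_comp_sub_right (Lp.coeFn_add f h) x] with t h1 h2 h3 h4 h5
  rw [h1, h4, h5]
  simp only [Pi.add_apply, h2, h3]
  ring

theorem timeFreqShift_smul (x ω : ℝ) (c : ℂ) (f : L2R) :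
    timeFreqShift x ω (c • f) = c • timeFreqShift x ω f := by
  apply Lp.ext
  filter_upwards [timeFreqShift_coe x ω (c • f), timeFreqShift_coe x ω f,
    Lp.coeFn_smul c (timeFreqShift x ω f),
    ae_comp_sub_right (Lp.coeFn_smul c f) x] with t h1 h2 h4 h5
  rw [h1, h4, h5]
  simp only [Pi.smul_apply, h2, smul_eq_mul]
  ring

theorem inner_timeFreqShift_timeFreqShift (x ω : ℝ) (f h : L2R) :
    inner ℂ (timeFreqShift x ω f) (timeFreqShift x ω h) = inner ℂ f h := by
  rw [L2.inner_def, L2.inner_def,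
    ← integral_sub_right_eq_self (fun t => inner ℂ (f t) (h t)) x]
  apply integral_congr_ae
  filter_upwards [timeFreqShift_coe x ω f, timeFreqShift_coe x ω h] with t h1 h2
  rw [h1, h2]
  simp only [RCLike.inner_apply, map_mul]
  have : conj (phase (ω * t)) * phase (ω * t) = 1 := by
    rw [conj_phase, phase_neg_mul_self]
  linear_combination (h (t - x) * conj (f (t - x))) * this

theorem norm_timeFreqShift (x ω : ℝ) (f : L2R) : ‖timeFreqShift x ω f‖ = ‖f‖ := by
  rw [@norm_eq_sqrt_re_inner ℂ, @norm_eq_sqrt_re_inner ℂ, inner_timeFreqShift_timeFreqShift]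

theorem timeFreqShift_timeFreqShift (x ω y η : ℝ) (f : L2R) :
    timeFreqShift x ω (timeFreqShift y η f)
      = phase (-(x * η)) • timeFreqShift (x + y) (ω + η) f := by
  apply Lp.ext
  filter_upwards [timeFreqShift_coe x ω (timeFreqShift y η f),
    timeFreqShift_coe (x + y) (ω + η) f,
    Lp.coeFn_smul (phase (-(x * η))) (timeFreqShift (x + y) (ω + η) f),
    ae_comp_sub_right (timeFreqShift_coe y η f) x] with t h1 h2 h4 h5
  rw [h1, h4, h5]
  simp only [Pi.smul_apply, h2, smul_eq_mul]
  rw [← mul_assoc, ← mul_assoc, ← phase_add, ← phase_add, sub_sub]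
  congr 2
  ring

theorem timeFreqShift_zero (f : L2R) : timeFreqShift 0 0 f = f := by
  apply Lp.ext
  filter_upwards [timeFreqShift_coe 0 0 f] with t h1
  rw [h1]; simp

/-- Time-frequency shifts as linear isometries. -/
noncomputable def shiftₗᵢ (x ω : ℝ) : L2R →ₗᵢ[ℂ] L2R where
  toFun := timeFreqShift x ω
  map_add' := timeFreqShift_add x ω
  map_smul' := timeFreqShift_smul x ω
  norm_map' := norm_timeFreqShift x ω

theorem timeFreqShift_comm (x ω y η : ℝ) (f : L2R) :
    timeFreqShift x ω (timeFreqShift y η f)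
      = phase (ω * y - x * η) • timeFreqShift y η (timeFreqShift x ω f) := by
  rw [timeFreqShift_timeFreqShift, timeFreqShift_timeFreqShift, smul_smul, ← phase_add,
    add_comm x y, add_comm ω η]
  congr 2
  ring

/-- Moving a time-frequency shift to the other side of the inner product. -/
theorem inner_timeFreqShift_right (x ω : ℝ) (f h : L2R) :
    inner ℂ h (timeFreqShift x ω f)
      = phase (x * ω) * inner ℂ (timeFreqShift (-x) (-ω) h) f := by
  rw [← inner_timeFreqShift_timeFreqShift (-x) (-ω) h, timeFreqShift_timeFreqShift, neg_add_cancel,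
    neg_add_cancel, timeFreqShift_zero, inner_smul_right]
  congr 2
  ring

theorem inner_timeFreqShift_neg_right (x ω y η : ℝ) (f h : L2R) :
    inner ℂ (timeFreqShift y η h) (timeFreqShift (-x) (-ω) f)
      = phase (x * ω + x * η) * inner ℂ (timeFreqShift (x + y) (ω + η) h) f := by
  rw [inner_timeFreqShift_right, neg_neg, neg_neg, timeFreqShift_timeFreqShift, inner_smul_left,
    conj_phase, ← mul_assoc, ← phase_add]
  congr 2
  ring

theorem continuous_translation (f : L2R) : Continuous fun x : ℝ => timeFreqShift x 0 f := by
  have h : ∀ x : ℝ, timeFreqShift x 0 f = Lp.compMeasurePreserving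
      (ContinuousMap.curry ⟨fun p : ℝ × ℝ => p.2 - p.1, by fun_prop⟩ x)
      (measurePreserving_sub_right volume x) f := by
    intro x
    apply Lp.ext
    filter_upwards [timeFreqShift_coe x 0 f, Lp.coeFn_compMeasurePreserving f
      (measurePreserving_sub_right volume x)] with t h1 h2
    rw [h1]
    refine Eq.trans ?_ h2.symm
    simp
  simp_rw [h]
  exact Continuous.compMeasurePreservingLp continuous_const (ContinuousMap.continuous _) _
    (by simp)

/-- Modulations preserve the norm, so ‖M_ω f - M_ω₀ f‖² is governed by one inner product, which is
continuous in ω by dominated convergence. -/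
theorem continuous_modulation (f : L2R) : Continuous fun ω : ℝ => timeFreqShift 0 ω f := by
  rw [continuous_iff_continuousAt]
  intro ω₀
  have hinner : ∀ ω, inner ℂ (timeFreqShift 0 ω₀ f) (timeFreqShift 0 ω f)
      = ∫ t, conj (phase (ω₀ * t)) * phase (ω * t) * inner ℂ (f t) (f t) := by
    intro ω
    rw [L2.inner_def]
    apply integral_congr_ae
    filter_upwards [timeFreqShift_coe 0 ω₀ f, timeFreqShift_coe 0 ω f] with t h1 h2
    rw [h1, h2]
    simp only [RCLike.inner_apply, map_mul, sub_zero]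
    ring
  have hint : Integrable (fun t => (inner ℂ (f t) (f t) : ℂ)) volume := L2.integrable_inner f f
  have hcont : Continuous fun ω => (inner ℂ (timeFreqShift 0 ω₀ f) (timeFreqShift 0 ω f) : ℂ) := by
    simp_rw [hinner]
    refine continuous_of_dominated (bound := fun t => ‖(inner ℂ (f t) (f t) : ℂ)‖) ?_ ?_
      hint.norm ?_
    · intro ω
      refine AEStronglyMeasurable.mul (Continuous.aestronglyMeasurable ?_) hint.1
      exact (Complex.continuous_conj.comp (continuous_phase.comp (by fun_prop))).mul
        (continuous_phase.comp (by fun_prop))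
    · intro ω
      refine Eventually.of_forall fun t => ?_
      simp only [norm_mul, RCLike.norm_conj, norm_phase, one_mul, le_refl]
    · refine Eventually.of_forall fun t => ?_
      exact (continuous_const.mul (continuous_phase.comp (by fun_prop))).mul continuous_const
  have hsq : ∀ ω, ‖timeFreqShift 0 ω f - timeFreqShift 0 ω₀ f‖ ^ 2
      = 2 * ‖f‖ ^ 2 - 2 * (inner ℂ (timeFreqShift 0 ω₀ f) (timeFreqShift 0 ω f) : ℂ).re := by
    intro ω
    have h := @norm_sub_sq ℂ L2R _ _ _ (timeFreqShift 0 ω₀ f) (timeFreqShift 0 ω f)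
    rw [norm_sub_rev, h, norm_timeFreqShift, norm_timeFreqShift]
    simp only [RCLike.re_to_complex]
    ring
  have hlim : Tendsto (fun ω => ‖timeFreqShift 0 ω f - timeFreqShift 0 ω₀ f‖ ^ 2) (𝓝 ω₀)
      (𝓝 (‖timeFreqShift 0 ω₀ f - timeFreqShift 0 ω₀ f‖ ^ 2)) := by
    simp_rw [hsq]
    exact (continuous_const.sub
      (continuous_const.mul (Complex.continuous_re.comp hcont))).tendsto ω₀
  rw [ContinuousAt, tendsto_iff_norm_sub_tendsto_zero]
  have := (Real.continuous_sqrt.tendsto _).comp hlim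
  simpa [Function.comp_def, Real.sqrt_sq] using this

/-- Separate continuity becomes joint continuity because all modulations are 1-Lipschitz. -/
theorem continuous_timeFreqShift (f : L2R) :
    Continuous fun z : ℝ × ℝ => timeFreqShift z.1 z.2 f := by
  have h : Continuous fun p : ℝ × L2R => timeFreqShift 0 p.1 p.2 :=
    continuous_prod_of_continuous_lipschitzWith' _ 1
      (fun ω => (shiftₗᵢ 0 ω).isometry.lipschitz) continuous_modulation
  have h2 : ∀ z : ℝ × ℝ, timeFreqShift z.1 z.2 f = timeFreqShift 0 z.2 (timeFreqShift z.1 0 f) := by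
    intro z
    rw [timeFreqShift_timeFreqShift]
    simp
  simp_rw [h2]
  exact h.comp (continuous_snd.prodMk ((continuous_translation f).comp continuous_fst))

/-! ### Plancherel for functions in `L¹ ∩ L²` -/

/-- Against a test function ψ both sides give ∫ 𝓕ψ · u: one by the distributional definition, the
other by the multiplication formula. Test functions determine locally integrable functions almost
everywhere. -/
theorem fourier_toLp_coe {u : ℝ → ℂ} (h1 : Integrable u) (h2 : MemLp u 2) :
    (𝓕 (h2.toLp u : L2R) : L2R) =ᵐ[volume] 𝓕 u := by
  have hloc : LocallyIntegrable (𝓕 (h2.toLp u : L2R) : L2R) volume :=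
    (Lp.memLp _).locallyIntegrable (by norm_num)
  have hcont : Continuous (𝓕 u) :=
    VectorFourier.fourierIntegral_continuous Real.continuous_fourierChar
      (by exact continuous_inner) h1
  refine ae_eq_of_integral_contDiff_smul_eq hloc hcont.locallyIntegrable ?_
  intro φ hφ hφc
  have hφ' : ContDiff ℝ ((⊤ : ℕ∞) : WithTop ℕ∞) (fun x => (φ x : ℂ)) :=
    Complex.ofRealCLM.contDiff.comp hφ
  have hφc' : HasCompactSupport (fun x => (φ x : ℂ)) := hφc.comp_left (g := fun r : ℝ => (r : ℂ)) (by simp)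
  let ψ : SchwartzMap ℝ ℂ := hφc'.toSchwartzMap hφ'
  have hψ : ∀ x, ψ x = (φ x : ℂ) := fun x => rfl
  have key := congrArg (fun T => T ψ) (Lp.fourier_toTemperedDistribution_eq (h2.toLp u : L2R))
  simp only [TemperedDistribution.fourier_apply, Lp.toTemperedDistribution_apply] at key
  have e1 : ∫ x, φ x • (𝓕 (h2.toLp u : L2R) : L2R) x
      = ∫ x, ψ x • (𝓕 (h2.toLp u : L2R) : L2R) x := by
    refine integral_congr_ae (Eventually.of_forall fun x => ?_)
    simp [hψ]
  rw [e1, ← key]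
  have e2 : ∫ x, (𝓕 ψ) x • (h2.toLp u : L2R) x = ∫ x, (𝓕 (ψ : ℝ → ℂ)) x • u x := by
    apply integral_congr_ae
    filter_upwards [h2.coeFn_toLp] with x hx
    rw [hx, SchwartzMap.fourier_coe]
  rw [e2]
  have := VectorFourier.integral_fourierIntegral_smul_eq_flip (L := innerₗ ℝ)
    (μ := volume) (ν := volume) (f := (ψ : ℝ → ℂ)) (g := u) Real.continuous_fourierChar
    (by exact continuous_inner) ψ.integrable h1
  rw [flip_innerₗ] at this
  refine this.trans (integral_congr_ae (Eventually.of_forall fun x => ?_))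
  simp only [hψ]
  rfl

theorem memLp_fourier {u : ℝ → ℂ} (h1 : Integrable u) (h2 : MemLp u 2) : MemLp (𝓕 u) 2 :=
  (memLp_congr_ae (fourier_toLp_coe h1 h2)).1 (Lp.memLp _)

theorem integral_conj_fourier_mul_fourier {u v : ℝ → ℂ} (hu1 : Integrable u) (hu2 : MemLp u 2)
    (hv1 : Integrable v) (hv2 : MemLp v 2) :
    ∫ ξ, conj (𝓕 u ξ) * 𝓕 v ξ = ∫ t, conj (u t) * v t := by
  have h := Lp.inner_fourier_eq (hu2.toLp u : L2R) (hv2.toLp v)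
  rw [L2.inner_def, L2.inner_def] at h
  refine Eq.trans (integral_congr_ae ?_) (h.trans (integral_congr_ae ?_))
  · filter_upwards [fourier_toLp_coe hu1 hu2, fourier_toLp_coe hv1 hv2] with x h1 h2
    rw [h1, h2, RCLike.inner_apply, mul_comm]
  · filter_upwards [hu2.coeFn_toLp, hv2.coeFn_toLp] with x h1 h2
    rw [h1, h2, RCLike.inner_apply, mul_comm]

/-! ### Moyal's orthogonality relations -/

theorem integrable_mul_comp_sub {u v : ℝ → ℂ} (hu : Integrable u) (hv : Integrable v) :
    Integrable (fun p : ℝ × ℝ => u p.2 * v (p.2 - p.1)) := by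
  have h := Integrable.convolution_integrand (ContinuousLinearMap.mul ℂ ℂ) hu hv.comp_neg
  rw [Measure.volume_eq_prod]
  simpa using h

theorem integral_mul_comp_sub {u v : ℝ → ℂ} (hu : Integrable u) (hv : Integrable v) :
    ∫ x, ∫ t, u t * v (t - x) = (∫ t, u t) * ∫ t, v t := by
  rw [integral_integral_swap (f := fun x t => u t * v (t - x)) (integrable_mul_comp_sub hu hv)]
  simp_rw [integral_const_mul, integral_sub_left_eq_self v volume]
  rw [integral_mul_const]

/-- The product `t ↦ f(t) \overline{g(t - x)}`. -/
noncomputable def shiftedProduct (g f : L2R) (x t : ℝ) : ℂ := f t * conj (g (t - x))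

/-- This makes Plancherel in ω available on each slice of fixed x. -/
theorem inner_timeFreqShift_eq_fourier (g f : L2R) (x ω : ℝ) :
    inner ℂ (timeFreqShift x ω g) f = 𝓕 (shiftedProduct g f x) ω := by
  rw [L2.inner_def, Real.fourier_real_eq_integral_exp_smul]
  apply integral_congr_ae
  filter_upwards [timeFreqShift_coe x ω g] with t h1
  rw [h1, RCLike.inner_apply, map_mul, conj_phase, phase_eq, shiftedProduct, smul_eq_mul]
  have : ((2 * Real.pi * -(ω * t) : ℝ) : ℂ) = ((-2 * Real.pi * t * ω : ℝ) : ℂ) := by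
    push_cast; ring
  rw [this]
  ring

theorem memLp_conj_comp_sub (g : L2R) (x : ℝ) : MemLp (fun t => conj (g (t - x))) 2 volume :=
  ((Lp.memLp g).comp_measurePreserving (measurePreserving_sub_right volume x)).star

theorem integrable_shiftedProduct (g f : L2R) (x : ℝ) : Integrable (shiftedProduct g f x) :=
  (Lp.memLp f).integrable_mul (memLp_conj_comp_sub g x)

theorem integrable_norm_sq (f : L2R) : Integrable (fun t => ((‖f t‖ ^ 2 : ℝ) : ℂ)) :=
  ((memLp_two_iff_integrable_sq_norm (Lp.aestronglyMeasurable f)).1 (Lp.memLp f)).ofReal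

theorem norm_sq_shiftedProduct (g f : L2R) (x t : ℝ) :
    ‖shiftedProduct g f x t‖ ^ 2 = ‖f t‖ ^ 2 * ‖g (t - x)‖ ^ 2 := by
  rw [shiftedProduct, norm_mul, RCLike.norm_conj, mul_pow]

theorem integrable_norm_sq_shiftedProduct (g f : L2R) :
    Integrable (fun p : ℝ × ℝ => ‖shiftedProduct g f p.1 p.2‖ ^ 2) := by
  have h := (integrable_mul_comp_sub (integrable_norm_sq f) (integrable_norm_sq g)).re
  refine h.congr (Eventually.of_forall fun p => ?_)
  simp only [norm_sq_shiftedProduct]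
  rw [← Complex.ofReal_mul]
  exact Complex.ofReal_re _

/-- A product of two L² functions is only in L¹ a priori; Fubini gives L² for almost every shift,
which is enough for slicewise Plancherel. -/
theorem ae_memLp_shiftedProduct (g f : L2R) :
    ∀ᵐ x : ℝ, MemLp (shiftedProduct g f x) 2 volume := by
  filter_upwards [(integrable_norm_sq_shiftedProduct g f).prod_right_ae] with x hx
  exact (memLp_two_iff_integrable_sq_norm (integrable_shiftedProduct g f x).1).2 hx

theorem continuous_inner_timeFreqShift (g f : L2R) :
    Continuous fun z : ℝ × ℝ => (inner ℂ (timeFreqShift z.1 z.2 g) f : ℂ) :=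
  (continuous_timeFreqShift g).inner continuous_const

theorem memLp_stft (g f : L2R) :
    MemLp (fun z : ℝ × ℝ => (inner ℂ (timeFreqShift z.1 z.2 g) f : ℂ)) 2 volume := by
  have hc := continuous_inner_timeFreqShift g f
  rw [memLp_two_iff_integrable_sq_norm hc.aestronglyMeasurable]
  have hx : ∀ᵐ x : ℝ, MemLp (fun ω => (inner ℂ (timeFreqShift x ω g) f : ℂ)) 2 volume := by
    filter_upwards [ae_memLp_shiftedProduct g f] with x h
    simp_rw [inner_timeFreqShift_eq_fourier]
    exact memLp_fourier (integrable_shiftedProduct g f x) h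
  rw [Measure.volume_eq_prod, integrable_prod_iff]
  · constructor
    · filter_upwards [hx] with x h
      exact (memLp_two_iff_integrable_sq_norm h.1).1 h
    · refine ((integrable_norm_sq_shiftedProduct g f).integral_prod_left).congr ?_
      filter_upwards [ae_memLp_shiftedProduct g f] with x h
      have hi := integrable_shiftedProduct g f x
      have := integral_conj_fourier_mul_fourier hi h hi h
      simp_rw [← Complex.normSq_eq_conj_mul_self, Complex.normSq_eq_norm_sq] at this
      rw [integral_complex_ofReal, integral_complex_ofReal] at this
      simp only [norm_pow, norm_norm, inner_timeFreqShift_eq_fourier]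
      exact (Complex.ofReal_injective this).symm
  · exact (hc.norm.pow 2).aestronglyMeasurable

theorem integrable_stft_mul_conj (g f γ h : L2R) :
    Integrable (fun z : ℝ × ℝ => (inner ℂ (timeFreqShift z.1 z.2 g) f : ℂ)
      * inner ℂ h (timeFreqShift z.1 z.2 γ)) := by
  have := (memLp_stft g f).integrable_mul (memLp_stft γ h).star
  refine this.congr (Eventually.of_forall fun z => ?_)
  simp

/-- **Moyal's formula**, the orthogonality relations of the short-time Fourier transform. -/
theorem integral_stft_mul_conj (g f γ h : L2R) :
    ∫ z : ℝ × ℝ, (inner ℂ (timeFreqShift z.1 z.2 g) f : ℂ) * inner ℂ h (timeFreqShift z.1 z.2 γ)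
      = inner ℂ h f * inner ℂ g γ := by
  have hint := integrable_stft_mul_conj g f γ h
  rw [Measure.volume_eq_prod] at hint ⊢
  rw [integral_prod _ hint]
  have hA : Integrable (fun t => (inner ℂ (h t) (f t) : ℂ)) := L2.integrable_inner h f
  have hB : Integrable (fun t => (inner ℂ (g t) (γ t) : ℂ)) := L2.integrable_inner g γ
  -- Plancherel in ω leaves a double integral of u(t)v(t - x), which factorizes.
  rw [L2.inner_def, L2.inner_def, ← integral_mul_comp_sub hA hB]
  apply integral_congr_ae
  filter_upwards [ae_memLp_shiftedProduct g f, ae_memLp_shiftedProduct γ h] with x h1 h2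
  have key := integral_conj_fourier_mul_fourier (integrable_shiftedProduct γ h x) h2
    (integrable_shiftedProduct g f x) h1
  refine Eq.trans (integral_congr_ae (Eventually.of_forall fun ω => ?_)) (key.trans
    (integral_congr_ae (Eventually.of_forall fun t => ?_)))
  · simp only [← inner_timeFreqShift_eq_fourier, inner_conj_symm]
    ring
  · simp only [shiftedProduct, RCLike.inner_apply, map_mul, Complex.conj_conj]
    ring

/-! ### Periodization over the integer lattice in the plane -/

/-- The half-open unit box in the plane. -/
def unitBox : Set (Fin 2 → ℝ) := {x | ∀ i, x i ∈ Set.Ioc (0 : ℝ) (0 + 1)}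

theorem measurableSet_unitBox : MeasurableSet unitBox :=
  MeasurableSet.univ_pi' fun _ => measurableSet_Ioc

/-- The real point with integer coordinates `n`. -/
def intPoint (n : Fin 2 → ℤ) : Fin 2 → ℝ := fun i => n i

/-- The translate of the unit box by the integer point `n`. -/
def shiftedBox (n : Fin 2 → ℤ) : Set (Fin 2 → ℝ) := (fun x => x + intPoint (-n)) ⁻¹' unitBox

/-- The boxes are closed on the right, hence ⌈x⌉ - 1 and not ⌊x⌋. -/
theorem mem_shiftedBox {n : Fin 2 → ℤ} {x : Fin 2 → ℝ} :
    x ∈ shiftedBox n ↔ ∀ i, n i = ⌈x i⌉ - 1 := by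
  simp only [shiftedBox, unitBox, intPoint, Set.mem_preimage, Set.mem_ofPred_eq, Pi.add_apply,
    Pi.neg_apply, Set.mem_Ioc, Int.cast_neg]
  refine forall_congr' fun i => ?_
  have : n i = ⌈x i⌉ - 1 ↔ ⌈x i⌉ = n i + 1 := by omega
  rw [this, Int.ceil_eq_iff]
  push_cast
  constructor <;> rintro ⟨h1, h2⟩ <;> constructor <;> linarith

theorem measurableSet_shiftedBox (n : Fin 2 → ℤ) : MeasurableSet (shiftedBox n) :=
  (measurable_add_const _) measurableSet_unitBox

theorem iUnion_shiftedBox : ⋃ n, shiftedBox n = Set.univ :=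
  Set.eq_univ_of_forall fun x => Set.mem_iUnion.2
    ⟨fun i => ⌈x i⌉ - 1, mem_shiftedBox.2 fun _ => rfl⟩

theorem pairwise_disjoint_shiftedBox : Pairwise (Function.onFun Disjoint shiftedBox) := by
  intro m n hmn
  refine Set.disjoint_left.2 fun x hm hn => hmn (funext fun i => ?_)
  rw [mem_shiftedBox.1 hm i, mem_shiftedBox.1 hn i]

theorem setIntegral_shiftedBox {E : Type*} [NormedAddCommGroup E] [NormedSpace ℝ E]
    (H : (Fin 2 → ℝ) → E) (n : Fin 2 → ℤ) :
    ∫ x in shiftedBox n, H x = ∫ x in unitBox, H (x + intPoint n) := by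
  have h := (measurePreserving_add_right (volume : Measure (Fin 2 → ℝ))
    (intPoint (-n))).setIntegral_preimage_emb (MeasurableEquiv.addRight _).measurableEmbedding
      (fun x => H (x + intPoint n)) unitBox
  rw [← h]
  refine setIntegral_congr_fun (measurableSet_shiftedBox n) fun x _ => ?_
  have : x + intPoint (-n) + intPoint n = x := by
    ext i; simp [intPoint]
  simp only [this]

/-- Integrating the periodization of a function over the unit box yields its full integral. -/
theorem integral_unitBox_tsum {H : (Fin 2 → ℝ) → ℂ} (hH : Integrable H) :
    ∫ x in unitBox, ∑' n : Fin 2 → ℤ, H (x + intPoint n) = ∫ x, H x := by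
  have h1 := hasSum_integral_iUnion (f := H) (μ := volume) measurableSet_shiftedBox
    pairwise_disjoint_shiftedBox hH.integrableOn
  -- The same decomposition of ‖H‖ supplies the summability that justifies exchanging sum and
  -- integral.
  have h2 := hasSum_integral_iUnion (f := fun x => ‖H x‖) (μ := volume) measurableSet_shiftedBox
    pairwise_disjoint_shiftedBox hH.norm.integrableOn
  simp only [iUnion_shiftedBox, setIntegral_univ, setIntegral_shiftedBox] at h1 h2
  have h3 := hasSum_integral_of_summable_integral_norm (μ := volume.restrict unitBox)
    (F := fun (n : Fin 2 → ℤ) x => H (x + intPoint n))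
    (fun n => (hH.comp_add_right (intPoint n)).integrableOn) h2.summable
  exact h3.unique h1

/-! ### Fourier series of doubly periodic functions -/

theorem mFourier_coe_apply (n : Fin 2 → ℤ) (x : Fin 2 → ℝ) :
    UnitAddTorus.mFourier n (fun i => (x i : UnitAddCircle))
      = phase (n 0 * x 0 + n 1 * x 1) := by
  rw [phase_add]
  simp only [UnitAddTorus.mFourier, ContinuousMap.coe_mk, Fin.prod_univ_two, fourier_coe_apply,
    phase]
  congr 2 <;> push_cast <;> ring

/-- The continuous function on the torus induced by a doubly periodic continuous function. -/
noncomputable def torusLift (F : (Fin 2 → ℝ) → ℂ) (hF : Continuous F)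
    (hper : ∀ (x : Fin 2 → ℝ) (n : Fin 2 → ℤ), F (x + intPoint n) = F x) :
    {f : C(UnitAddTorus (Fin 2), ℂ) // ∀ x : Fin 2 → ℝ, f (fun i => (x i : UnitAddCircle)) = F x} := by
  have hq : IsOpenQuotientMap
      (Pi.map fun _ : Fin 2 => ((↑) : ℝ → UnitAddCircle)) :=
    IsOpenQuotientMap.piMap fun _ => QuotientAddGroup.isOpenQuotientMap_mk
  let f : UnitAddTorus (Fin 2) → ℂ := fun t => F fun i => AddCircle.equivIoc (1 : ℝ) 0 (t i)
  have hf : ∀ x : Fin 2 → ℝ, f (fun i => (x i : UnitAddCircle)) = F x := by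
    intro x
    have hx : ∀ i, ∃ m : ℤ, ((AddCircle.equivIoc (1 : ℝ) 0 (x i : UnitAddCircle) : ℝ)) = x i + m := by
      intro i
      refine ⟨-toIocDiv one_pos 0 (x i), ?_⟩
      change toIocMod one_pos 0 (x i) = _
      simp [toIocMod, sub_eq_add_neg]
    choose m hm using hx
    rw [← hper x m]
    exact congrArg F (funext hm)
  refine ⟨⟨f, hq.isQuotientMap.continuous_iff.2 ?_⟩, hf⟩
  have : f ∘ (Pi.map fun _ : Fin 2 => ((↑) : ℝ → UnitAddCircle)) = F := funext hf
  rw [this]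
  exact hF

theorem mFourierCoeff_torusLift (F : (Fin 2 → ℝ) → ℂ) (hF : Continuous F)
    (hper : ∀ (x : Fin 2 → ℝ) (n : Fin 2 → ℤ), F (x + intPoint n) = F x) (n : Fin 2 → ℤ) :
    UnitAddTorus.mFourierCoeff (torusLift F hF hper).1 n
      = ∫ x in unitBox, phase (-(n 0 * x 0 + n 1 * x 1)) * F x := by
  rw [UnitAddTorus.mFourierCoeff_eq_integral _ _ 0]
  refine integral_congr_ae (Eventually.of_forall fun x => ?_)
  simp only [mFourier_coe_apply, (torusLift F hF hper).2, smul_eq_mul]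
  congr 2
  simp
  ring

/-- A doubly periodic continuous function with summable Fourier coefficients is the sum of its
Fourier series at the origin. -/
theorem hasSum_fourierCoeff_of_periodic (F : (Fin 2 → ℝ) → ℂ) (hF : Continuous F)
    (hper : ∀ (x : Fin 2 → ℝ) (n : Fin 2 → ℤ), F (x + intPoint n) = F x)
    (hs : Summable fun n : Fin 2 → ℤ =>
      ∫ x in unitBox, phase (-(n 0 * x 0 + n 1 * x 1)) * F x) :
    HasSum (fun n : Fin 2 → ℤ => ∫ x in unitBox, phase (-(n 0 * x 0 + n 1 * x 1)) * F x) (F 0) := by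
  have hs' : Summable (UnitAddTorus.mFourierCoeff (torusLift F hF hper).1) := by
    refine hs.congr fun n => ?_
    rw [mFourierCoeff_torusLift]
  have h := UnitAddTorus.hasSum_mFourier_series_apply_of_summable hs'
    (fun i => (((0 : Fin 2 → ℝ) i : ℝ) : UnitAddCircle))
  simp only [mFourierCoeff_torusLift, mFourier_coe_apply, (torusLift F hF hper).2] at h
  simpa using h

theorem integral_unitBox_phase (n : Fin 2 → ℤ) :
    ∫ x in unitBox, phase (-(n 0 * x 0 + n 1 * x 1)) = if n = 0 then 1 else 0 := by
  have h := (orthonormal_iff_ite.1 (UnitAddTorus.orthonormal_mFourier (d := Fin 2))) n 0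
  rw [UnitAddTorus.mFourierLp, UnitAddTorus.mFourierLp, ContinuousMap.inner_toLp] at h
  rw [← h, UnitAddTorus.integral_preimage _ 0]
  refine integral_congr_ae (Eventually.of_forall fun x => ?_)
  simp only [UnitAddTorus.mFourier_zero, mFourier_coe_apply, conj_phase]
  simp

/-! ### Coefficients of periodized correlations -/

/-- The scaling map `θ ↦ (aθ₀, bθ₁)` from the plane to the time-frequency plane. -/
def scaleMap (a b : ℝ) (θ : Fin 2 → ℝ) : ℝ × ℝ := (a * θ 0, b * θ 1)

theorem continuous_scaleMap (a b : ℝ) : Continuous (scaleMap a b) := by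
  unfold scaleMap; fun_prop

theorem map_scaleMap {a b : ℝ} (ha : 0 < a) (hb : 0 < b) :
    Measure.map (scaleMap a b) volume = ENNReal.ofReal (a * b)⁻¹ • (volume : Measure (ℝ × ℝ)) := by
  have h1 : scaleMap a b = Prod.map (a * ·) (b * ·) ∘ MeasurableEquiv.finTwoArrow := by
    ext θ <;> simp [scaleMap, MeasurableEquiv.finTwoArrow]
  rw [h1, ← Measure.map_map (by fun_prop) (MeasurableEquiv.measurable _),
    (volume_preserving_finTwoArrow ℝ).map_eq, Measure.volume_eq_prod,
    ← Measure.map_prod_map _ _ (by fun_prop) (by fun_prop), Real.map_volume_mul_left ha.ne',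
    Real.map_volume_mul_left hb.ne', Measure.prod_smul_left, Measure.prod_smul_right, smul_smul,
    ← ENNReal.ofReal_mul (abs_nonneg _), ← abs_mul, ← mul_inv, abs_of_pos (by positivity)]

theorem integrable_comp_scaleMap {a b : ℝ} (ha : 0 < a) (hb : 0 < b) {H : ℝ × ℝ → ℂ}
    (hH : Integrable H) (hc : Continuous H) : Integrable (fun θ => H (scaleMap a b θ)) := by
  refine (integrable_map_measure hc.aestronglyMeasurable
    (continuous_scaleMap a b).measurable.aemeasurable).1 ?_
  rw [map_scaleMap ha hb]
  exact hH.smul_measure ENNReal.ofReal_ne_top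

theorem integral_comp_scaleMap {a b : ℝ} (ha : 0 < a) (hb : 0 < b) {H : ℝ × ℝ → ℂ}
    (hc : Continuous H) : ∫ θ, H (scaleMap a b θ) = ((a * b : ℝ) : ℂ)⁻¹ * ∫ z, H z := by
  rw [← integral_map (continuous_scaleMap a b).measurable.aemeasurable hc.aestronglyMeasurable,
    map_scaleMap ha hb, integral_smul_measure, ENNReal.toReal_ofReal (by positivity),
    Complex.real_smul]
  push_cast
  rfl

/-- The shift by `-(aθ₀, bθ₁)`. -/
noncomputable def backShift (a b : ℝ) (θ : Fin 2 → ℝ) (f : L2R) : L2R :=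
  timeFreqShift (-(a * θ 0)) (-(b * θ 1)) f

theorem backShift_zero (a b : ℝ) (f : L2R) : backShift a b 0 f = f := by
  simp [backShift, timeFreqShift_zero]

theorem continuous_backShift (a b : ℝ) (f : L2R) : Continuous fun θ => backShift a b θ f :=
  (continuous_timeFreqShift f).comp
    (f := fun θ : Fin 2 → ℝ => (-(a * θ 0), -(b * θ 1))) (by fun_prop)

/-- The periodized correlation `∑ₙ ⟨f_θ, g_n⟩ ⟨γ_n, h_θ⟩` of two Gabor systems. -/
noncomputable def periodizedCorrelation (g γ f h : L2R) (a b : ℝ) (θ : Fin 2 → ℝ) : ℂ :=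
  ∑' n : ℤ × ℤ, inner ℂ (gaborAtom g a b n) (backShift a b θ f)
    * inner ℂ (backShift a b θ h) (gaborAtom γ a b n)

/-- The phases produced in the two factors are conjugate and cancel, leaving the periodization of a
product of two short-time Fourier transforms. -/
theorem periodizedCorrelation_eq (g γ f h : L2R) (a b : ℝ) (θ : Fin 2 → ℝ) :
    periodizedCorrelation g γ f h a b θ = ∑' n : Fin 2 → ℤ,
      inner ℂ (timeFreqShift (scaleMap a b (θ + intPoint n)).1
        (scaleMap a b (θ + intPoint n)).2 g) f *
      inner ℂ h (timeFreqShift (scaleMap a b (θ + intPoint n)).1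
        (scaleMap a b (θ + intPoint n)).2 γ) := by
  rw [periodizedCorrelation, ← (finTwoArrowEquiv ℤ).tsum_eq]
  refine tsum_congr fun n => ?_
  have e1 : (scaleMap a b (θ + intPoint n)).1 = a * θ 0 + n 0 * a := by
    simp [scaleMap, intPoint]; ring
  have e2 : (scaleMap a b (θ + intPoint n)).2 = b * θ 1 + n 1 * b := by
    simp [scaleMap, intPoint]; ring
  rw [e1, e2]
  have e3 : finTwoArrowEquiv ℤ n = (n 0, n 1) := rfl
  simp only [e3, gaborAtom, backShift]
  rw [inner_timeFreqShift_neg_right, ← inner_conj_symm (timeFreqShift (-(a * θ 0)) _ h),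
    inner_timeFreqShift_neg_right, map_mul, conj_phase, inner_conj_symm]
  linear_combination (inner ℂ (timeFreqShift (a * θ 0 + n 0 * a) (b * θ 1 + n 1 * b) g) f *
    inner ℂ h (timeFreqShift (a * θ 0 + n 0 * a) (b * θ 1 + n 1 * b) γ)) *
      phase_self_mul_neg (a * θ 0 * (b * θ 1) + a * θ 0 * (n 1 * b))

theorem periodizedCorrelation_periodic (g γ f h : L2R) (a b : ℝ) (θ : Fin 2 → ℝ)
    (m : Fin 2 → ℤ) :
    periodizedCorrelation g γ f h a b (θ + intPoint m) = periodizedCorrelation g γ f h a b θ := by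
  rw [periodizedCorrelation_eq, periodizedCorrelation_eq,
    ← (Equiv.addLeft m).tsum_eq (fun n : Fin 2 → ℤ =>
      inner ℂ (timeFreqShift (scaleMap a b (θ + intPoint n)).1
        (scaleMap a b (θ + intPoint n)).2 g) f *
      inner ℂ h (timeFreqShift (scaleMap a b (θ + intPoint n)).1
        (scaleMap a b (θ + intPoint n)).2 γ))]
  refine tsum_congr fun n => ?_
  have : θ + intPoint m + intPoint n = θ + intPoint (Equiv.addLeft m n) := by
    ext i; simp [intPoint, add_assoc]
  rw [this]

/-- The Fourier coefficients of the periodized correlation are products of inner products over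
the adjoint lattice. -/
theorem integral_periodizedCorrelation (g γ f h : L2R) {a b : ℝ} (ha : 0 < a) (hb : 0 < b)
    (n : Fin 2 → ℤ) :
    ∫ θ in unitBox, phase (-(n 0 * θ 0 + n 1 * θ 1)) * periodizedCorrelation g γ f h a b θ
      = ((a * b : ℝ) : ℂ)⁻¹ * (inner ℂ (adjointAtom h a b (-n 1, n 0)) f
        * inner ℂ g (adjointAtom γ a b (-n 1, n 0))) := by
  -- Commuting the shift by (aθ₀, bθ₁) past the adjoint shift p costs the phase θ₁p₁ - θ₀p₂. This
  -- quarter turn makes it the character -n·θ, so Moyal applied to γ_p and h_p yields the n-th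
  -- coefficient.
  set p : ℤ × ℤ := (-n 1, n 0)
  let H : ℝ × ℝ → ℂ := fun z => inner ℂ (timeFreqShift z.1 z.2 g) f
    * inner ℂ (adjointAtom h a b p) (timeFreqShift z.1 z.2 (adjointAtom γ a b p))
  have hc : Continuous H := (continuous_inner_timeFreqShift g f).mul
    (continuous_const.inner (continuous_timeFreqShift _))
  have hi : Integrable H := integrable_stft_mul_conj _ _ _ _
  rw [← integral_stft_mul_conj, ← integral_comp_scaleMap ha hb hc,
    ← integral_unitBox_tsum (integrable_comp_scaleMap ha hb hi hc)]
  refine integral_congr_ae (Eventually.of_forall fun θ => ?_)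
  simp only [periodizedCorrelation_eq, ← tsum_mul_left]
  refine tsum_congr fun m => ?_
  simp only [H, adjointAtom]
  rw [timeFreqShift_comm _ _ (p.1 / b), inner_smul_right, inner_timeFreqShift_timeFreqShift]
  have e : (scaleMap a b (θ + intPoint m)).2 * (p.1 / b)
      - (scaleMap a b (θ + intPoint m)).1 * (p.2 / a)
      = -(n 0 * θ 0 + n 1 * θ 1) + ((-(m 1 * n 1) - m 0 * n 0 : ℤ) : ℝ) := by
    simp only [scaleMap, intPoint, Pi.add_apply, p]
    push_cast
    field_simp
    ring
  rw [e, phase_add_intCast]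
  ring

theorem adjointAtom_zero (g : L2R) (a b : ℝ) : adjointAtom g a b (0, 0) = g := by
  simp [adjointAtom, timeFreqShift_zero]

theorem norm_adjointAtom (g : L2R) (a b : ℝ) (p : ℤ × ℤ) : ‖adjointAtom g a b p‖ = ‖g‖ :=
  norm_timeFreqShift _ _ _

/-- **Wexler-Raz**: a window `γ` whose Gabor system is dual to that of `g` is biorthogonal to the
adjoint system of `g`. -/
theorem inner_adjointAtom_of_dual {g γ : L2R} {a b : ℝ} (ha : 0 < a) (hb : 0 < b)
    (hg : g ≠ 0)
    (hdual : ∀ f, HasSum (fun n => inner ℂ (gaborAtom g a b n) f • gaborAtom γ a b n) f)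
    (p : ℤ × ℤ) :
    inner ℂ g (adjointAtom γ a b p) = if p = (0, 0) then ((a * b : ℝ) : ℂ) else 0 := by
  have hconst : ∀ f h : L2R, ∀ θ, periodizedCorrelation g γ f h a b θ = inner ℂ h f := by
    intro f h θ
    have h1 := (hdual (backShift a b θ f)).mapL (innerSL ℂ (backShift a b θ h))
    simp only [innerSL_apply_apply, inner_smul_right] at h1
    rw [periodizedCorrelation, h1.tsum_eq]
    exact inner_timeFreqShift_timeFreqShift _ _ _ _
  have hab : ((a * b : ℝ) : ℂ) ≠ 0 := by
    exact_mod_cast (mul_pos ha hb).ne'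
  -- With f = g_p and h = g the other factor is ‖g_p‖² ≠ 0 and can be cancelled. The index undoes
  -- the quarter turn (-n₁, n₀).
  have key := integral_periodizedCorrelation g γ (adjointAtom g a b p) g ha hb ![p.2, -p.1]
  simp only [hconst] at key
  rw [integral_mul_const, integral_unitBox_phase] at key
  simp only [Matrix.cons_val_zero, Matrix.cons_val_one, neg_neg] at key
  have hgg : (inner ℂ (adjointAtom g a b p) (adjointAtom g a b p) : ℂ) ≠ 0 := by
    rw [adjointAtom, inner_timeFreqShift_timeFreqShift]
    exact inner_self_ne_zero.2 hg
  split_ifs with hp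
  · subst hp
    rw [if_pos (by ext i; fin_cases i <;> simp), one_mul, adjointAtom_zero] at key
    rw [adjointAtom_zero] at hgg key
    field_simp at key
    rw [adjointAtom_zero, key]
  · rw [if_neg, zero_mul, eq_comm, mul_eq_zero, or_iff_right (inv_ne_zero hab), mul_eq_zero,
      or_iff_right hgg] at key
    · exact key
    · intro h0
      apply hp
      have h1 := congrFun h0 0
      have h2 := congrFun h0 1
      simp at h1 h2
      exact Prod.ext h2 h1

/-- **Janssen's representation** of the frame operator over the adjoint lattice, in weak form. -/
theorem hasSum_inner_frameOp {g : L2R} {a b : ℝ} (ha : 0 < a) (hb : 0 < b) {S : L2R →L[ℂ] L2R}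
    (hS : ∀ f, HasSum (fun n => inner ℂ (gaborAtom g a b n) f • gaborAtom g a b n) (S f))
    (hs : Summable fun p => ‖(inner ℂ g (adjointAtom g a b p) : ℂ)‖) (f h : L2R) :
    HasSum (fun p : ℤ × ℤ => ((a * b : ℝ) : ℂ)⁻¹ * (inner ℂ (adjointAtom h a b p) f
        * inner ℂ g (adjointAtom g a b p))) (inner ℂ h (S f)) := by
  have heq : ∀ θ, periodizedCorrelation g g f h a b θ
      = inner ℂ (backShift a b θ h) (S (backShift a b θ f)) := by
    intro θ
    have h1 := (hS (backShift a b θ f)).mapL (innerSL ℂ (backShift a b θ h))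
    simp only [innerSL_apply_apply, inner_smul_right] at h1
    rw [periodizedCorrelation, h1.tsum_eq]
  -- Boundedness of S gives the continuity needed to evaluate the Fourier series at the single point
  -- θ = 0.
  have hc : Continuous fun θ => periodizedCorrelation g g f h a b θ := by
    simp_rw [heq]
    exact (continuous_backShift a b h).inner (S.continuous.comp (continuous_backShift a b f))
  let e : (Fin 2 → ℤ) ≃ ℤ × ℤ :=
    { toFun := fun n => (-n 1, n 0)
      invFun := fun p => ![p.2, -p.1]
      left_inv := fun n => by ext i; fin_cases i <;> simp
      right_inv := fun p => by simp }
  have hsum : Summable fun p : ℤ × ℤ => ((a * b : ℝ) : ℂ)⁻¹ * (inner ℂ (adjointAtom h a b p) f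
        * inner ℂ g (adjointAtom g a b p)) := by
    refine Summable.mul_left _ (Summable.of_norm_bounded (hs.mul_left (‖h‖ * ‖f‖)) fun p => ?_)
    rw [norm_mul]
    gcongr
    exact (norm_inner_le_norm _ _).trans (by rw [norm_adjointAtom])
  have key := hasSum_fourierCoeff_of_periodic (fun θ => periodizedCorrelation g g f h a b θ) hc
    (periodizedCorrelation_periodic g g f h a b) (by
      simp_rw [integral_periodizedCorrelation g g f h ha hb]
      exact e.summable_iff.2 hsum)
  simp_rw [integral_periodizedCorrelation g g f h ha hb] at key
  rw [heq, backShift_zero, backShift_zero] at key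
  exact e.hasSum_iff.1 key

/-! ### Exponential decay of the Gram matrix over the adjoint lattice -/

theorem integrable_exp_neg_mul_abs {c : ℝ} (hc : 0 < c) :
    Integrable fun t : ℝ => Real.exp (-c * |t|) := by
  have h1 : IntegrableOn (fun t : ℝ => Real.exp (-c * |t|)) (Set.Ioi 0) := by
    refine (exp_neg_integrableOn_Ioi 0 hc).congr_fun (fun t ht => ?_) measurableSet_Ioi
    simp only [abs_of_pos (Set.mem_Ioi.1 ht)]
  have h2 : IntegrableOn (fun t : ℝ => Real.exp (-c * |t|)) (Set.Iio 0) := by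
    have h := (Measure.measurePreserving_neg (volume : Measure ℝ)).integrableOn_comp_preimage
      (Homeomorph.neg ℝ).measurableEmbedding (f := fun t : ℝ => Real.exp (-c * |t|))
      (s := Set.Ioi 0) |>.2 h1
    simpa [Function.comp_def] using h
  have := ((integrableOn_Iic_iff_integrableOn_Iio).2 h2).union h1
  rwa [Set.Iic_union_Ioi, integrableOn_univ] at this

/-- Half of the exponent pays for |x| through the triangle inequality; the rest keeps the product
integrable in t. -/
theorem exp_neg_mul_abs_mul_le {c : ℝ} (hc : 0 < c) (x t : ℝ) :
    Real.exp (-c * |t - x|) * Real.exp (-c * |t|)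
      ≤ Real.exp (-(c / 2) * |x|) * Real.exp (-(c / 2) * |t|) := by
  rw [← Real.exp_add, ← Real.exp_add]
  apply Real.exp_le_exp.2
  have h1 : |x| ≤ |t - x| + |t| := by
    have := abs_sub t (t - x)
    rw [sub_sub_cancel] at this
    linarith
  have h2 := abs_nonneg (t - x)
  nlinarith

/-- The correlation of an exponentially decaying function with its translates decays
exponentially. -/
theorem norm_integral_le_of_exp_decay {F G : ℝ → ℂ} {c C x : ℝ} (hc : 0 < c)
    (hF : ∀ᵐ t, ‖F t‖ ≤ C * Real.exp (-c * |t|))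
    (hG : ∀ᵐ t, ‖G t‖ ≤ C * Real.exp (-c * |t - x|)) :
    ‖∫ t, conj (G t) * F t‖
      ≤ C ^ 2 * (∫ t : ℝ, Real.exp (-(c / 2) * |t|)) * Real.exp (-(c / 2) * |x|) := by
  have hi : Integrable fun t : ℝ => C ^ 2 * Real.exp (-(c / 2) * |x|) * Real.exp (-(c / 2) * |t|) :=
    (integrable_exp_neg_mul_abs (half_pos hc)).const_mul _
  refine (norm_integral_le_of_norm_le hi ?_).trans ?_
  · filter_upwards [hF, hG] with t h1 h2
    rw [norm_mul, RCLike.norm_conj]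
    calc ‖G t‖ * ‖F t‖ ≤ (C * Real.exp (-c * |t - x|)) * (C * Real.exp (-c * |t|)) :=
          mul_le_mul h2 h1 (norm_nonneg _) ((norm_nonneg _).trans h2)
      _ = C ^ 2 * (Real.exp (-c * |t - x|) * Real.exp (-c * |t|)) := by ring
      _ ≤ C ^ 2 * (Real.exp (-(c / 2) * |x|) * Real.exp (-(c / 2) * |t|)) := by
          exact mul_le_mul_of_nonneg_left (exp_neg_mul_abs_mul_le hc x t) (sq_nonneg C)
      _ = _ := by ring
  · rw [integral_const_mul]
    exact le_of_eq (by ring)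

theorem inner_timeFreqShift_self_eq (g : L2R) (x ω : ℝ) :
    inner ℂ (timeFreqShift x ω g) g = ∫ t, conj (phase (ω * t) * g (t - x)) * g t := by
  rw [L2.inner_def]
  apply integral_congr_ae
  filter_upwards [timeFreqShift_coe x ω g] with t h1
  rw [h1, RCLike.inner_apply, mul_comm]

theorem integrable_of_exp_decay {g : L2R} {c C : ℝ} (hc : 0 < c)
    (hg : ∀ᵐ t : ℝ, ‖g t‖ ≤ C * Real.exp (-c * |t|)) : Integrable (fun t => g t) :=
  ((integrable_exp_neg_mul_abs hc).const_mul C).mono' (Lp.aestronglyMeasurable g) hg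

theorem norm_inner_timeFreqShift_le_time {g : L2R} {c C : ℝ} (hc : 0 < c)
    (hg : ∀ᵐ t : ℝ, ‖g t‖ ≤ C * Real.exp (-c * |t|)) (x ω : ℝ) :
    ‖(inner ℂ (timeFreqShift x ω g) g : ℂ)‖
      ≤ C ^ 2 * (∫ t : ℝ, Real.exp (-(c / 2) * |t|)) * Real.exp (-(c / 2) * |x|) := by
  rw [inner_timeFreqShift_self_eq]
  refine norm_integral_le_of_exp_decay hc hg ?_
  filter_upwards [ae_comp_sub_right hg x] with t h
  rwa [norm_mul, norm_phase, one_mul]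

theorem fourier_phase_mul_comp_sub (u : ℝ → ℂ) (x ω ξ : ℝ) :
    𝓕 (fun t => phase (ω * t) * u (t - x)) ξ = phase (-(x * (ξ - ω))) * 𝓕 u (ξ - ω) := by
  have h : ∀ (v : ℝ → ℂ) (η : ℝ), 𝓕 v η = ∫ t, phase (-(t * η)) * v t := by
    intro v η
    rw [Real.fourier_real_eq_integral_exp_smul]
    refine integral_congr_ae (Eventually.of_forall fun t => ?_)
    simp only [phase_eq, smul_eq_mul]
    congr 3
    push_cast
    ring
  rw [h, h, ← integral_const_mul,
    ← integral_sub_right_eq_self (fun t => phase (-(x * (ξ - ω))) * (phase (-(t * (ξ - ω))) * u t)) x]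
  refine integral_congr_ae (Eventually.of_forall fun t => ?_)
  simp only [← mul_assoc, ← phase_add]
  congr 2
  ring

theorem norm_inner_timeFreqShift_le_freq {g : L2R} {c D : ℝ} (hc : 0 < c)
    (hi : Integrable (fun t => g t))
    (hg : ∀ ξ : ℝ, ‖𝓕 (fun t : ℝ => g t) ξ‖ ≤ D * Real.exp (-c * |ξ|)) (x ω : ℝ) :
    ‖(inner ℂ (timeFreqShift x ω g) g : ℂ)‖
      ≤ D ^ 2 * (∫ t : ℝ, Real.exp (-(c / 2) * |t|)) * Real.exp (-(c / 2) * |ω|) := by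
  have h2 : MemLp (fun t => phase (ω * t) * g (t - x)) 2 volume :=
    (memLp_congr_ae (timeFreqShift_coe x ω g)).1 (Lp.memLp _)
  have h1 : Integrable (fun t => phase (ω * t) * g (t - x)) := by
    refine (hi.comp_sub_right x).mono h2.1 (Eventually.of_forall fun t => ?_)
    rw [norm_mul, norm_phase, one_mul]
  rw [inner_timeFreqShift_self_eq,
    ← integral_conj_fourier_mul_fourier (v := fun t => g t) h1 h2 hi (Lp.memLp g)]
  refine norm_integral_le_of_exp_decay hc (Eventually.of_forall hg) (Eventually.of_forall fun ξ => ?_)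
  rw [fourier_phase_mul_comp_sub, norm_mul, norm_phase, one_mul]
  exact hg _

/-- The Gram matrix over the adjoint lattice of a window with exponential decay in time and
frequency decays exponentially away from the diagonal. -/
theorem exists_exp_decay_inner_adjointAtom {g : L2R} {a b c C D : ℝ} (ha : 0 < a) (hb : 0 < b)
    (hc : 0 < c) (hg : ∀ᵐ t : ℝ, ‖g t‖ ≤ C * Real.exp (-c * |t|))
    (hg' : ∀ ξ : ℝ, ‖𝓕 (fun t : ℝ => g t) ξ‖ ≤ D * Real.exp (-c * |ξ|)) :
    ∃ s : ℝ, 0 < s ∧ ∃ E : ℝ, 0 ≤ E ∧ ∀ p : ℤ × ℤ, ‖(inner ℂ g (adjointAtom g a b p) : ℂ)‖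
      ≤ E * Real.exp (-(2 * s) * (|(p.1 : ℝ)| + |(p.2 : ℝ)|)) := by
  set I := ∫ t : ℝ, Real.exp (-(c / 2) * |t|)
  have hI : 0 ≤ I := integral_nonneg fun t => (Real.exp_pos _).le
  set E := max (C ^ 2 * I) (D ^ 2 * I)
  have hE : 0 ≤ E := le_max_of_le_left (by positivity)
  -- Time decay gives rate c/(2b) in k and frequency decay gives rate c/(2a) in l; both are at least
  -- 4s.
  set s := min (c / (8 * a)) (c / (8 * b))
  have hs : 0 < s := lt_min (by positivity) (by positivity)
  refine ⟨s, hs, E, hE, fun p => ?_⟩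
  rw [← norm_inner_symm, adjointAtom]
  set v := ‖(inner ℂ (timeFreqShift (p.1 / b) (p.2 / a) g) g : ℂ)‖
  have hv : 0 ≤ v := norm_nonneg _
  have h1 : v ≤ E * Real.exp (-(4 * s) * |(p.1 : ℝ)|) := by
    refine (norm_inner_timeFreqShift_le_time hc hg (p.1 / b) (p.2 / a)).trans
      (mul_le_mul (le_max_left _ _) (Real.exp_le_exp.2 ?_) (Real.exp_pos _).le hE)
    rw [abs_div, abs_of_pos hb]
    have : 4 * s ≤ c / 2 / b := by
      have := min_le_right (c / (8 * a)) (c / (8 * b))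
      calc 4 * s ≤ 4 * (c / (8 * b)) := by gcongr
        _ = c / 2 / b := by field_simp; norm_num
    calc -(c / 2) * (|(p.1 : ℝ)| / b) = -(c / 2 / b * |(p.1 : ℝ)|) := by ring
      _ ≤ -(4 * s * |(p.1 : ℝ)|) := by gcongr
      _ = _ := by ring
  have h2 : v ≤ E * Real.exp (-(4 * s) * |(p.2 : ℝ)|) := by
    refine (norm_inner_timeFreqShift_le_freq hc (integrable_of_exp_decay hc hg) hg'
      (p.1 / b) (p.2 / a)).trans
      (mul_le_mul (le_max_right _ _) (Real.exp_le_exp.2 ?_) (Real.exp_pos _).le hE)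
    rw [abs_div, abs_of_pos ha]
    have : 4 * s ≤ c / 2 / a := by
      have := min_le_left (c / (8 * a)) (c / (8 * b))
      calc 4 * s ≤ 4 * (c / (8 * a)) := by gcongr
        _ = c / 2 / a := by field_simp; norm_num
    calc -(c / 2) * (|(p.2 : ℝ)| / a) = -(c / 2 / a * |(p.2 : ℝ)|) := by ring
      _ ≤ -(4 * s * |(p.2 : ℝ)|) := by gcongr
      _ = _ := by ring
  -- The geometric mean of the two bounds decays in both indices at once, at half the rate.
  refine abs_le_of_sq_le_sq' ?_ (by positivity) |>.2
  calc v ^ 2 = v * v := sq v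
    _ ≤ (E * Real.exp (-(4 * s) * |(p.1 : ℝ)|)) * (E * Real.exp (-(4 * s) * |(p.2 : ℝ)|)) :=
        mul_le_mul h1 h2 hv (hv.trans h1)
    _ = _ := by
        rw [mul_pow, ← Real.exp_nat_mul, mul_mul_mul_comm, ← Real.exp_add, ← sq]
        congr 2
        push_cast
        ring

/-- The weight `e^{s(|k|+|l|)}` on the index lattice. -/
noncomputable def expWeight (s : ℝ) (p : ℤ × ℤ) : ℝ :=
  Real.exp (s * (|(p.1 : ℝ)| + |(p.2 : ℝ)|))

theorem expWeight_pos (s : ℝ) (p : ℤ × ℤ) : 0 < expWeight s p := Real.exp_pos _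

theorem expWeight_sub_le {s : ℝ} (hs : 0 ≤ s) (p q : ℤ × ℤ) :
    expWeight s (q - p) ≤ expWeight s p * expWeight s q := by
  rw [expWeight, expWeight, expWeight, ← Real.exp_add, ← mul_add]
  refine Real.exp_le_exp.2 (mul_le_mul_of_nonneg_left ?_ hs)
  have h1 := abs_sub (q.1 : ℝ) p.1
  have h2 := abs_sub (q.2 : ℝ) p.2
  simp only [Prod.fst_sub, Prod.snd_sub, Int.cast_sub]
  linarith

theorem summable_exp_neg_mul_abs_int {s : ℝ} (hs : 0 < s) :
    Summable fun k : ℤ => Real.exp (-s * |(k : ℝ)|) := by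
  have h : Summable fun n : ℕ => Real.exp (-s * n) := by
    have := summable_geometric_of_lt_one (Real.exp_pos (-s)).le (Real.exp_lt_one_iff.2 (neg_lt_zero.2 hs))
    refine this.congr fun n => ?_
    rw [← Real.exp_nat_mul, mul_comm]
  refine Summable.of_nat_of_neg ?_ ?_ <;> simpa using h

/-- The decay has rate 2s and the weight only rate s, so a summable factor e^{-s(|k|+|l|)} is left.
-/
theorem summable_mul_expWeight {s E : ℝ} (hs : 0 < s) {α : ℤ × ℤ → ℂ}
    (hα : ∀ p : ℤ × ℤ, ‖α p‖ ≤ E * Real.exp (-(2 * s) * (|(p.1 : ℝ)| + |(p.2 : ℝ)|))) :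
    Summable fun p => ‖α p‖ * expWeight s p := by
  have h1 := summable_exp_neg_mul_abs_int hs
  have h2 := (h1.mul_of_nonneg h1 (fun _ => (Real.exp_pos _).le)
    (fun _ => (Real.exp_pos _).le)).mul_left E
  refine Summable.of_nonneg_of_le (fun p => by positivity [expWeight_pos s p]) (fun p => ?_) h2
  calc ‖α p‖ * expWeight s p
      ≤ E * Real.exp (-(2 * s) * (|(p.1 : ℝ)| + |(p.2 : ℝ)|)) * expWeight s p := by
        gcongr
        · exact (expWeight_pos s p).le
        · exact hα p
    _ = _ := by
        rw [expWeight, mul_assoc, ← Real.exp_add, ← Real.exp_add]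
        congr 2
        ring

/-! ### The frame operator -/

section Bessel

variable {ι E : Type*} [NormedAddCommGroup E] [InnerProductSpace ℂ E]

theorem memlp_inner_of_summable {φ : ι → E} {f : E}
    (h : Summable fun i => ‖(inner ℂ (φ i) f : ℂ)‖ ^ 2) :
    Memℓp (fun i => (inner ℂ (φ i) f : ℂ)) 2 :=
  memℓp_gen (by simpa using h)

/-- A Bessel sequence has a bounded frame operator. -/
theorem exists_frameOp_of_bessel [CompleteSpace E] [DecidableEq ι] {φ : ι → E} {B : ℝ} (hB : 0 ≤ B)
    (hs : ∀ f, Summable fun i => ‖(inner ℂ (φ i) f : ℂ)‖ ^ 2)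
    (hle : ∀ f, ∑' i, ‖(inner ℂ (φ i) f : ℂ)‖ ^ 2 ≤ B * ‖f‖ ^ 2) :
    ∃ S : E →L[ℂ] E, (∀ f, HasSum (fun i => (inner ℂ (φ i) f : ℂ) • φ i) (S f)) ∧
      (∀ f, (inner ℂ f (S f) : ℂ) = ((∑' i, ‖(inner ℂ (φ i) f : ℂ)‖ ^ 2 : ℝ) : ℂ)) ∧
      ∀ f, ‖S f‖ ≤ B * ‖f‖ := by
  let V₀ : E →ₗ[ℂ] lp (fun _ : ι => ℂ) 2 :=
    { toFun := fun f => ⟨fun i => inner ℂ (φ i) f, memlp_inner_of_summable (hs f)⟩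
      map_add' := fun f h => Subtype.ext (funext fun i => inner_add_right _ _ _)
      map_smul' := fun c f => Subtype.ext (funext fun i => inner_smul_right _ _ _) }
  have hV₀ : ∀ f i, V₀ f i = inner ℂ (φ i) f := fun f i => rfl
  have hnorm : ∀ f, ‖V₀ f‖ ^ 2 = ∑' i, ‖(inner ℂ (φ i) f : ℂ)‖ ^ 2 := by
    intro f
    have := lp.norm_rpow_eq_tsum (p := 2) (by norm_num) (V₀ f)
    simpa [hV₀] using this
  have hbound : ∀ f, ‖V₀ f‖ ≤ √B * ‖f‖ := by
    intro f
    refine (sq_le_sq₀ (norm_nonneg _) (by positivity)).1 ?_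
    rw [hnorm, mul_pow, Real.sq_sqrt hB]
    exact hle f
  let V : E →L[ℂ] lp (fun _ : ι => ℂ) 2 := V₀.mkContinuous (√B) hbound
  have hV : ∀ f, V f = V₀ f := fun f => rfl
  have hVnorm : ‖V‖ ≤ √B := V₀.mkContinuous_norm_le (Real.sqrt_nonneg _) hbound
  -- V is the analysis operator; its adjoint is synthesis, so V*V applied to f is the frame series.
  have hadj : ∀ (i : ι) (c : ℂ), V.adjoint (lp.single 2 i c) = c • φ i := by
    intro i c
    refine ext_inner_left ℂ fun x => ?_
    rw [ContinuousLinearMap.adjoint_inner_right, lp.inner_single_right, hV, hV₀,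
      inner_smul_right, RCLike.inner_apply, inner_conj_symm]
  refine ⟨V.adjoint ∘L V, fun f => ?_, fun f => ?_, fun f => ?_⟩
  · have h1 := (lp.hasSum_single (p := 2) (by norm_num) (V f)).mapL V.adjoint
    simpa only [hadj, hV, hV₀, ContinuousLinearMap.comp_apply] using h1
  · rw [ContinuousLinearMap.comp_apply, ContinuousLinearMap.adjoint_inner_right,
      inner_self_eq_norm_sq_to_K, hV, ← hnorm]
    push_cast
    rfl
  · calc ‖V.adjoint (V f)‖ ≤ ‖V.adjoint‖ * ‖V f‖ := V.adjoint.le_opNorm _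
      _ ≤ √B * (√B * ‖f‖) := by
          gcongr
          · rw [LinearIsometryEquiv.norm_map]; exact hVnorm
          · exact hbound f
      _ = B * ‖f‖ := by rw [← mul_assoc, Real.mul_self_sqrt hB]

end Bessel

/-- The Neumann step `1 - tS` with `t = A / B²` is a strict contraction if `A ≤ S` and `‖S‖ ≤ B`. -/
theorem norm_sub_smul_apply_le {E : Type*} [NormedAddCommGroup E] [InnerProductSpace ℂ E]
    {S : E →L[ℂ] E} {A B : ℝ} (hA : 0 < A) (hB : 0 < B) (hAB : A ≤ B)
    (hlow : ∀ f, A * ‖f‖ ^ 2 ≤ (inner ℂ f (S f) : ℂ).re) (hup : ∀ f, ‖S f‖ ≤ B * ‖f‖) (f : E) :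
    ‖f - ((A / B ^ 2 : ℝ) : ℂ) • S f‖ ≤ √(1 - (A / B) ^ 2) * ‖f‖ := by
  have h01 : (A / B) ^ 2 ≤ 1 :=
    pow_le_one₀ (by positivity) ((div_le_one hB).2 hAB)
  refine (sq_le_sq₀ (norm_nonneg _) (by positivity)).1 ?_
  rw [mul_pow, Real.sq_sqrt (by linarith), @norm_sub_sq ℂ, inner_smul_right, norm_smul]
  simp only [RCLike.re_to_complex, Complex.re_ofReal_mul, Complex.norm_real, Real.norm_eq_abs]
  have ht : 0 < A / B ^ 2 := by positivity
  rw [abs_of_pos ht]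
  -- The squared norm is at most (1 - 2tA + t²B²)‖f‖², minimized by t = A/B².
  have h1 : (A / B ^ 2 * ‖S f‖) ^ 2 ≤ (A / B ^ 2 * (B * ‖f‖)) ^ 2 := by
    gcongr
    exact hup f
  have h2 : A / B ^ 2 * (A * ‖f‖ ^ 2) ≤ A / B ^ 2 * (inner ℂ f (S f) : ℂ).re := by
    gcongr
    exact hlow f
  have e1 : (A / B ^ 2 * (B * ‖f‖)) ^ 2 = (A / B) ^ 2 * ‖f‖ ^ 2 := by
    field_simp
  have e2 : A / B ^ 2 * (A * ‖f‖ ^ 2) = (A / B) ^ 2 * ‖f‖ ^ 2 := by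
    field_simp
  nlinarith

/-- Testing the frame inequality on a nonzero vector yields A ≤ B and g ≠ 0. -/
instance : Nontrivial L2R := by
  let s : Set ℝ := Set.Ioc 0 1
  refine ⟨indicatorConstLp 2 (measurableSet_Ioc (a := (0 : ℝ)) (b := 1)) (by simp) (1 : ℂ), 0, ?_⟩
  intro h
  have := congrArg norm h
  rw [norm_indicatorConstLp (by norm_num) (by norm_num)] at this
  simp at this

theorem _root_.IsGaborFrame.le {g : L2R} {a b A B : ℝ} (h : IsGaborFrame g a b A B) : A ≤ B := by
  obtain ⟨f, hf⟩ := exists_ne (0 : L2R)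
  have h1 := (h.2.2 f).2.1.trans (h.2.2 f).2.2
  exact le_of_mul_le_mul_right h1 (by positivity)

theorem _root_.IsGaborFrame.ne_zero {g : L2R} {a b A B : ℝ} (h : IsGaborFrame g a b A B) : g ≠ 0 := by
  rintro rfl
  obtain ⟨f, hf⟩ := exists_ne (0 : L2R)
  have h0 : ∀ n, gaborAtom (0 : L2R) a b n = 0 := fun n => (shiftₗᵢ _ _).map_zero
  have h1 := (h.2.2 f).2.1
  simp only [h0, inner_zero_left, norm_zero, ne_eq, OfNat.ofNat_ne_zero, not_false_eq_true,
    zero_pow, tsum_zero] at h1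
  have : 0 < A * ‖f‖ ^ 2 := mul_pos h.1 (by positivity)
  linarith

theorem _root_.IsGaborFrame.exists_frameOp {g : L2R} {a b A B : ℝ} (h : IsGaborFrame g a b A B) :
    ∃ S : L2R →L[ℂ] L2R,
      (∀ f, HasSum (fun n => (inner ℂ (gaborAtom g a b n) f : ℂ) • gaborAtom g a b n) (S f)) ∧
      (∀ f, A * ‖f‖ ^ 2 ≤ (inner ℂ f (S f) : ℂ).re) ∧ ∀ f, ‖S f‖ ≤ B * ‖f‖ := by
  obtain ⟨S, h1, h2, h3⟩ := exists_frameOp_of_bessel h.2.1.le (fun f => (h.2.2 f).1)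
    (fun f => (h.2.2 f).2.2)
  refine ⟨S, h1, fun f => ?_, h3⟩
  rw [h2, Complex.ofReal_re]
  exact (h.2.2 f).2.1

/-- A bounded operator with `A ≤ S` and `‖S‖ ≤ B` is invertible. -/
theorem exists_inverse_of_bounds {E : Type*} [NormedAddCommGroup E] [InnerProductSpace ℂ E]
    [CompleteSpace E] {S : E →L[ℂ] E} {A B : ℝ} (hA : 0 < A) (hB : 0 < B) (hAB : A ≤ B)
    (hlow : ∀ f, A * ‖f‖ ^ 2 ≤ (inner ℂ f (S f) : ℂ).re) (hup : ∀ f, ‖S f‖ ≤ B * ‖f‖) :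
    ∃ R : E →L[ℂ] E, (∀ f, R (S f) = f) ∧ ∀ f, S (R f) = f := by
  set t : ℂ := ((A / B ^ 2 : ℝ) : ℂ)
  have hq : √(1 - (A / B) ^ 2) < 1 := by
    rw [Real.sqrt_lt' one_pos]
    have : 0 < (A / B) ^ 2 := by positivity
    linarith
  have hT : ‖(1 : E →L[ℂ] E) - t • S‖ < 1 :=
    (ContinuousLinearMap.opNorm_le_bound _ (Real.sqrt_nonneg _)
      (norm_sub_smul_apply_le hA hB hAB hlow hup)).trans_lt hq
  have hu := isUnit_one_sub_of_norm_lt_one hT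
  rw [sub_sub_cancel] at hu
  obtain ⟨u, hu⟩ := hu
  have h1 : (↑u⁻¹ : E →L[ℂ] E) * (t • S) = 1 := by rw [← hu, Units.inv_mul]
  have h2 : (t • S) * (↑u⁻¹ : E →L[ℂ] E) = 1 := by rw [← hu, Units.mul_inv]
  refine ⟨t • (↑u⁻¹ : E →L[ℂ] E), fun f => ?_, fun f => ?_⟩
  · have := congrArg (fun L => L f) h1
    simpa using this
  · have := congrArg (fun L => L f) h2
    simpa using this

/-! ### Consequences of Janssen's representation -/

section Janssen

variable {g : L2R} {a b : ℝ}

theorem timeFreqShift_surjective (x ω : ℝ) (f : L2R) : ∃ h, timeFreqShift x ω h = f := by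
  refine ⟨phase (-(x * ω)) • timeFreqShift (-x) (-ω) f, ?_⟩
  rw [timeFreqShift_smul, timeFreqShift_timeFreqShift, smul_smul, ← phase_add, add_neg_cancel,
    add_neg_cancel, timeFreqShift_zero]
  simp

/-- Adjoint lattice shifts commute with lattice shifts. -/
theorem adjointAtom_gaborAtom (ha : 0 < a) (hb : 0 < b) (h : L2R) (n p : ℤ × ℤ) :
    adjointAtom (gaborAtom h a b n) a b p = gaborAtom (adjointAtom h a b p) a b n := by
  rw [adjointAtom, gaborAtom, timeFreqShift_comm]
  have : (p.2 / a * (n.1 * a) - p.1 / b * (n.2 * b) : ℝ) = ((p.2 * n.1 - p.1 * n.2 : ℤ) : ℝ) := by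
    push_cast
    field_simp
  rw [this, phase_intCast, one_smul, gaborAtom, adjointAtom]

/-- The frame operator commutes with lattice shifts. -/
theorem frameOp_gaborAtom (ha : 0 < a) (hb : 0 < b) {S : L2R →L[ℂ] L2R}
    (hS : ∀ f, HasSum (fun n => (inner ℂ (gaborAtom g a b n) f : ℂ) • gaborAtom g a b n) (S f))
    (hs : Summable fun p => ‖(inner ℂ g (adjointAtom g a b p) : ℂ)‖) (f : L2R) (n : ℤ × ℤ) :
    S (gaborAtom f a b n) = gaborAtom (S f) a b n := by
  refine ext_inner_left ℂ fun x => ?_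
  obtain ⟨h, rfl⟩ := timeFreqShift_surjective (n.1 * a) (n.2 * b) x
  have h1 := hasSum_inner_frameOp ha hb hS hs (gaborAtom f a b n) (gaborAtom h a b n)
  have h2 := hasSum_inner_frameOp ha hb hS hs f h
  -- Janssen's series sees f and h only through ⟨f, h_p⟩, which is unchanged when both are moved by
  -- the same lattice shift.
  have e : ∀ p, (inner ℂ (adjointAtom (gaborAtom h a b n) a b p) (gaborAtom f a b n) : ℂ)
      = inner ℂ (adjointAtom h a b p) f := fun p => by
    rw [adjointAtom_gaborAtom ha hb]
    exact inner_timeFreqShift_timeFreqShift _ _ _ _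
  simp only [e] at h1
  refine (h1.unique h2).trans ?_
  exact (inner_timeFreqShift_timeFreqShift _ _ _ _).symm

/-- One θ serves all h and f; this uniformity in h turns the weak form of Janssen's formula into an
identity of vectors. -/
theorem exists_phase_inner_adjointAtom (a b : ℝ) (p q : ℤ × ℤ) :
    ∃ θ : ℝ, ∀ h f : L2R, (inner ℂ (adjointAtom h a b p) (adjointAtom f a b q) : ℂ)
      = phase θ * inner ℂ h (adjointAtom f a b (q - p)) := by
  refine ⟨-(p.1 / b * (p.2 / a)) + p.1 / b * (q.2 / a), fun h f => ?_⟩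
  rw [← inner_conj_symm, adjointAtom.eq_1 h, inner_timeFreqShift_right, adjointAtom.eq_1 f,
    timeFreqShift_timeFreqShift, map_mul, inner_conj_symm, inner_smul_right, conj_phase,
    ← mul_assoc, ← phase_add, adjointAtom]
  have e1 : -((p.1 : ℝ) / b) + q.1 / b = ((q - p).1 : ℝ) / b := by
    push_cast [Prod.fst_sub]; ring
  have e2 : -((p.2 : ℝ) / a) + q.2 / a = ((q - p).2 : ℝ) / a := by
    push_cast [Prod.snd_sub]; ring
  rw [e1, e2]
  congr 2
  ring

/-- The frame operator acts on the adjoint system as a twisted convolution. -/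
theorem exists_hasSum_frameOp_adjointAtom (ha : 0 < a) (hb : 0 < b) {S : L2R →L[ℂ] L2R}
    (hS : ∀ f, HasSum (fun n => (inner ℂ (gaborAtom g a b n) f : ℂ) • gaborAtom g a b n) (S f))
    (hs : Summable fun p => ‖(inner ℂ g (adjointAtom g a b p) : ℂ)‖) (q : ℤ × ℤ) :
    ∃ c : ℤ × ℤ → ℂ, (∀ p, ‖c p‖ = (a * b)⁻¹ * ‖(inner ℂ g (adjointAtom g a b p) : ℂ)‖) ∧
      HasSum (fun p => c p • adjointAtom g a b (q - p)) (S (adjointAtom g a b q)) := by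
  choose θ hθ using fun p : ℤ × ℤ => exists_phase_inner_adjointAtom a b p q
  set α : ℤ × ℤ → ℂ := fun p => inner ℂ g (adjointAtom g a b p)
  let c : ℤ × ℤ → ℂ := fun p => ((a * b : ℝ) : ℂ)⁻¹ * (phase (θ p) * α p)
  have hc : ∀ p, ‖c p‖ = (a * b)⁻¹ * ‖α p‖ := by
    intro p
    simp only [c, norm_mul, norm_inv, norm_phase, one_mul, Complex.norm_real, Real.norm_eq_abs]
    simp only [abs_of_pos ha, abs_of_pos hb]
  have hsum : Summable fun p => c p • adjointAtom g a b (q - p) := by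
    refine Summable.of_norm ((hs.mul_left ((a * b)⁻¹ * ‖g‖)).congr fun p => ?_)
    rw [norm_smul, hc, norm_adjointAtom]
    ring
  refine ⟨c, hc, ?_⟩
  have heq : ∑' p, c p • adjointAtom g a b (q - p) = S (adjointAtom g a b q) := by
    refine ext_inner_left ℂ fun h => ?_
    have h1 := hsum.hasSum.mapL (innerSL ℂ h)
    have h2 := hasSum_inner_frameOp ha hb hS hs (adjointAtom g a b q) h
    refine h1.unique ?_
    refine h2.congr_fun ?_
    intro p
    simp only [innerSL_apply_apply, inner_smul_right, hθ, c, α]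
    ring
  rw [← heq]
  exact hsum.hasSum

end Janssen

/-! ### The dual window and its finite sections -/

/-- The properties of a Gabor system used below: its frame operator `S` with frame bounds `A, B`,
and the biorthogonality of the dual window `γ = S⁻¹g` to the adjoint system. -/
structure IsDualWindow (g γ : L2R) (a b A B : ℝ) (S : L2R →L[ℂ] L2R) : Prop where
  hasSum_apply : ∀ f,
    HasSum (fun n => (inner ℂ (gaborAtom g a b n) f : ℂ) • gaborAtom g a b n) (S f)
  lower_bound : ∀ f, A * ‖f‖ ^ 2 ≤ (inner ℂ f (S f) : ℂ).re
  norm_apply_le : ∀ f, ‖S f‖ ≤ B * ‖f‖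
  apply_eq : S γ = g
  biorthogonal : ∀ p, (inner ℂ (adjointAtom g a b p) γ : ℂ)
    = if p = (0, 0) then ((a * b : ℝ) : ℂ) else 0

/-- S commutes with lattice shifts, hence so does R = S⁻¹. Applying R to the series of S f turns
each g_n into γ_n, so γ is a dual window and Wexler-Raz applies. -/
theorem _root_.IsGaborFrame.exists_isDualWindow {g : L2R} {a b A B : ℝ} (ha : 0 < a) (hb : 0 < b)
    (h : IsGaborFrame g a b A B)
    (hs : Summable fun p => ‖(inner ℂ g (adjointAtom g a b p) : ℂ)‖) :
    ∃ S : L2R →L[ℂ] L2R, IsDualWindow g (gaborDualWindow g a b) a b A B S := by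
  obtain ⟨S, hS, hlow, hup⟩ := h.exists_frameOp
  obtain ⟨R, hRS, hSR⟩ := exists_inverse_of_bounds h.1 h.2.1 h.le hlow hup
  have hop : gaborFrameOp g a b = S := funext fun f => (hS f).tsum_eq
  have hγ : S (gaborDualWindow g a b) = g := by
    rw [gaborDualWindow, hop]
    exact Function.invFun_eq ⟨R g, hSR g⟩
  refine ⟨S, hS, hlow, hup, hγ, ?_⟩
  set γ := gaborDualWindow g a b
  have hdual : ∀ f, HasSum
      (fun n => (inner ℂ (gaborAtom g a b n) f : ℂ) • gaborAtom γ a b n) f := by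
    intro f
    have h1 := (hS f).mapL R
    rw [hRS] at h1
    refine h1.congr_fun fun n => ?_
    rw [map_smul, ← hRS (gaborAtom γ a b n), frameOp_gaborAtom ha hb hS hs, hγ]
  intro p
  -- Moving the shift from g to γ replaces p by -p, up to a phase.
  obtain ⟨θ, hθ⟩ := exists_phase_inner_adjointAtom a b p (0, 0)
  have h1 := inner_adjointAtom_of_dual ha hb h.ne_zero hdual
  by_cases hp : p = (0, 0)
  · have := h1 (0, 0)
    rw [adjointAtom_zero] at this
    rw [hp, adjointAtom_zero, this]
  · have := hθ g γ
    rw [adjointAtom_zero, h1, if_neg, mul_zero] at this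
    · rw [this, if_neg hp]
    · intro h0
      apply hp
      simpa [Prod.ext_iff] using h0

section Sections

variable {g γ : L2R} {a b A B : ℝ} {S : L2R →L[ℂ] L2R}

/-- The dual window has norm at most `A^{-1/2}`. -/
theorem IsDualWindow.norm_le (h : IsDualWindow g γ a b A B S) (hA : 0 < A) (ha : 0 < a)
    (hb : 0 < b) : ‖γ‖ ≤ 1 / √A := by
  have hgγ : (inner ℂ g γ : ℂ) = ((a * b : ℝ) : ℂ) := by
    have := h.biorthogonal (0, 0)
    rwa [adjointAtom_zero, if_pos rfl] at this
  have hγg : (inner ℂ γ g : ℂ) = ((a * b : ℝ) : ℂ) := by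
    rw [← inner_conj_symm, hgγ, Complex.conj_ofReal]
  have hsum : HasSum (fun n => ‖(inner ℂ (gaborAtom g a b n) γ : ℂ)‖ ^ 2) (a * b) := by
    have h1 := (h.hasSum_apply γ).mapL (innerSL ℂ γ)
    rw [h.apply_eq, innerSL_apply_apply, hγg] at h1
    have h2 := h1.mapL Complex.reCLM
    simp only [Complex.reCLM_apply, Complex.ofReal_re, innerSL_apply_apply, inner_smul_right] at h2
    refine h2.congr_fun fun n => ?_
    rw [← inner_conj_symm γ, Complex.mul_conj, Complex.ofReal_re, Complex.normSq_eq_norm_sq]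
  have h0 : gaborAtom g a b (0, 0) = g := by simp [gaborAtom, timeFreqShift_zero]
  have hab : 0 < a * b := mul_pos ha hb
  -- The sum is ⟨Sγ, γ⟩ = ab, and its (0,0) term alone is |⟨γ, g⟩|² = (ab)². This forces the density
  -- bound ab ≤ 1, so A‖γ‖² ≤ ⟨Sγ, γ⟩ ≤ 1.
  have h1 : (a * b) ^ 2 ≤ a * b := by
    have := le_hasSum hsum (0, 0) fun n _ => sq_nonneg _
    rw [h0, hgγ, Complex.norm_real, Real.norm_eq_abs, sq_abs] at this
    exact this
  have h2 : a * b ≤ 1 := by nlinarith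
  have h3 : A * ‖γ‖ ^ 2 ≤ 1 := by
    have := h.lower_bound γ
    rw [h.apply_eq, hγg, Complex.ofReal_re] at this
    exact this.trans h2
  rw [le_div_iff₀ (Real.sqrt_pos.2 hA)]
  refine (sq_le_sq₀ (by positivity) zero_le_one).1 ?_
  rw [mul_pow, Real.sq_sqrt hA.le]
  linarith

theorem IsDualWindow.inner_adjointAtom_adjointAtom (h : IsDualWindow g γ a b A B S)
    {p q : ℤ × ℤ} (hpq : p ≠ q) :
    (inner ℂ (adjointAtom γ a b q) (adjointAtom g a b p) : ℂ) = 0 := by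
  obtain ⟨θ, hθ⟩ := exists_phase_inner_adjointAtom a b q p
  rw [hθ, ← inner_conj_symm, h.biorthogonal, if_neg, map_zero, mul_zero]
  exact sub_ne_zero.2 hpq

theorem IsDualWindow.inner_adjointAtom_self (h : IsDualWindow g γ a b A B S) (q : ℤ × ℤ) :
    (inner ℂ (adjointAtom γ a b q) (adjointAtom g a b q) : ℂ) = ((a * b : ℝ) : ℂ) := by
  have := h.biorthogonal (0, 0)
  rw [adjointAtom_zero, if_pos rfl] at this
  rw [adjointAtom, adjointAtom, inner_timeFreqShift_timeFreqShift, ← inner_conj_symm, this,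
    Complex.conj_ofReal]

theorem inner_adjointAtom_sectionSynthesis (g : L2R) (a b : ℝ) (n : ℕ) (c : sectionIndex n → ℂ)
    (p : sectionIndex n) :
    (inner ℂ (adjointAtom g a b p) (sectionSynthesis g a b n c) : ℂ)
      = (gramSection g a b n).mulVec c p := by
  rw [sectionSynthesis, inner_sum, Matrix.mulVec, dotProduct]
  refine Finset.sum_congr rfl fun q _ => ?_
  rw [inner_smul_right, gramSection, mul_comm]

/-- The finite sections of the Gram matrix are invertible. -/
theorem IsDualWindow.isUnit_gramSection (h : IsDualWindow g γ a b A B S) (ha : 0 < a) (hb : 0 < b)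
    (n : ℕ) : IsUnit (gramSection g a b n) := by
  rw [← Matrix.mulVec_injective_iff_isUnit]
  intro c d hcd
  have hG : (gramSection g a b n).mulVec (c - d) = 0 := by
    rw [Matrix.mulVec_sub, sub_eq_zero]
    exact hcd
  -- A kernel vector of a Gram matrix synthesizes to 0; pairing with the biorthogonal γ_q then reads
  -- off its coefficients.
  have hv : sectionSynthesis g a b n (c - d) = 0 := by
    rw [← @inner_self_eq_zero ℂ]
    nth_rw 1 [sectionSynthesis]
    rw [sum_inner]
    refine Finset.sum_eq_zero fun p _ => ?_
    rw [inner_smul_left, inner_adjointAtom_sectionSynthesis, hG, Pi.zero_apply, mul_zero]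
  ext q
  have hq : (inner ℂ (adjointAtom γ a b q) (sectionSynthesis g a b n (c - d)) : ℂ)
      = (c - d) q * ((a * b : ℝ) : ℂ) := by
    rw [sectionSynthesis, inner_sum, Finset.sum_eq_single q]
    · rw [inner_smul_right, h.inner_adjointAtom_self]
    · intro p _ hpq
      rw [inner_smul_right, h.inner_adjointAtom_adjointAtom (Subtype.coe_ne_coe.2 hpq), mul_zero]
    · intro hq
      exact absurd (Finset.mem_univ q) hq
  rw [hv, inner_zero_right, eq_comm, mul_eq_zero, or_iff_left] at hq
  · exact sub_eq_zero.1 hq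
  · exact_mod_cast (mul_pos ha hb).ne'

/-- The span of the adjoint system over the `n`-th index section. -/
noncomputable def sectionSpan (g : L2R) (a b : ℝ) (n : ℕ) : Submodule ℂ L2R :=
  Submodule.span ℂ (Set.range fun p : sectionIndex n => adjointAtom g a b p)

instance (g : L2R) (a b : ℝ) (n : ℕ) : FiniteDimensional ℂ (sectionSpan g a b n) :=
  FiniteDimensional.span_of_finite ℂ (Set.finite_range _)

/-- The finite-section approximation is the orthogonal projection of the dual window. -/
theorem IsDualWindow.starProjection_eq (h : IsDualWindow g γ a b A B S) (ha : 0 < a) (hb : 0 < b)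
    (n : ℕ) : (sectionSpan g a b n).starProjection γ = dualWindowSection g a b n := by
  refine Submodule.eq_starProjection_of_mem_orthogonal (K := sectionSpan g a b n) ?_ ?_
  · exact Submodule.sum_mem _ fun p _ => Submodule.smul_mem _ _ (Submodule.subset_span ⟨p, rfl⟩)
  · rw [sectionSpan, Submodule.mem_orthogonal]
    intro u hu
    induction hu using Submodule.span_induction with
    | mem x hx =>
      obtain ⟨p, rfl⟩ := hx
      have hdet := (Matrix.isUnit_iff_isUnit_det _).1 (h.isUnit_gramSection ha hb n)
      simp only [inner_sub_right]
      rw [h.biorthogonal, dualWindowSection, inner_adjointAtom_sectionSynthesis,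
        Matrix.mulVec_mulVec, Matrix.mul_nonsing_inv _ hdet, Matrix.one_mulVec, sigmaSection,
        sub_self]
    | zero => exact inner_zero_left _
    | add x y _ _ hx hy => rw [inner_add_left, hx, hy, add_zero]
    | smul c x _ hx => rw [inner_smul_left, hx, mul_zero]

end Sections

/-! ### Approximation by truncated Neumann series -/

/-- Iterating an operator that acts on a family of vectors as a convolution with coefficients of
finite weighted `ℓ¹` norm expands weighted bounds at most geometrically. -/
theorem norm_iterate_le {E : Type*} [NormedAddCommGroup E] [NormedSpace ℂ E]
    {e : ℤ × ℤ → E} {T : E →L[ℂ] E} {S : E →L[ℂ] E} {t : ℝ} (ht : 0 ≤ t)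
    (hT : ∀ f, T f = f - (t : ℂ) • S f) {r : ℤ × ℤ → ℝ} {s : ℝ} (hs : 0 ≤ s)
    (hr : Summable fun p => r p * expWeight s p)
    (hS : ∀ q, ∃ c : ℤ × ℤ → ℂ, (∀ p, ‖c p‖ = r p) ∧ HasSum (fun p => c p • e (q - p)) (S (e q)))
    {Q : E →L[ℂ] E} {ε : ℝ} (hQ : ∀ q, ‖Q (e q)‖ ≤ expWeight s q * ε) (hε : 0 ≤ ε) (k : ℕ) :
    ∀ q, ‖Q ((T ^ k) (e q))‖
      ≤ (1 + t * ∑' p, r p * expWeight s p) ^ k * (expWeight s q * ε) := by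
  set W := ∑' p, r p * expWeight s p
  have hr0 : ∀ p, 0 ≤ r p := fun p => by
    obtain ⟨c, hc, -⟩ := hS 0
    rw [← hc]; exact norm_nonneg _
  have hW : 0 ≤ W := tsum_nonneg fun p => mul_nonneg (hr0 p) (expWeight_pos s p).le
  induction k with
  | zero => simpa using hQ
  | succ k ih =>
    intro q
    obtain ⟨c, hc, hcS⟩ := hS q
    set M := 1 + t * W
    have hM : 0 ≤ M := by positivity
    -- S spreads e_q over all e_{q-p}, so the induction needs the bound at every index.
    -- Submultiplicativity of the weight makes the total cost the weighted ℓ¹ norm W.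
    have h1 : ‖Q ((T ^ k) (S (e q)))‖ ≤ M ^ k * (expWeight s q * ε) * W := by
      have h2 := hcS.mapL (Q ∘L T ^ k)
      have h3 : HasSum (fun p => M ^ k * (expWeight s q * ε) * (r p * expWeight s p))
          (M ^ k * (expWeight s q * ε) * W) := hr.hasSum.mul_left _
      refine h2.norm_le_of_bounded h3 fun p => ?_
      rw [map_smul, norm_smul, hc, ContinuousLinearMap.comp_apply]
      calc r p * ‖Q ((T ^ k) (e (q - p)))‖
          ≤ r p * (M ^ k * (expWeight s (q - p) * ε)) :=
            mul_le_mul_of_nonneg_left (ih _) (hr0 p)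
        _ ≤ r p * (M ^ k * ((expWeight s p * expWeight s q) * ε)) := by
            have := expWeight_sub_le hs p q
            have := hr0 p
            gcongr
        _ = _ := by ring
    rw [pow_succ, mul_apply_eq_comp, hT, map_sub, map_sub, map_smul, map_smul]
    calc ‖Q ((T ^ k) (e q)) - (t : ℂ) • Q ((T ^ k) (S (e q)))‖
        ≤ ‖Q ((T ^ k) (e q))‖ + t * ‖Q ((T ^ k) (S (e q)))‖ := by
          refine (norm_sub_le _ _).trans ?_
          rw [norm_smul, Complex.norm_real, Real.norm_of_nonneg ht]
      _ ≤ M ^ k * (expWeight s q * ε) + t * (M ^ k * (expWeight s q * ε) * W) := by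
          gcongr
          exact ih q
      _ = M ^ (k + 1) * (expWeight s q * ε) := by
          simp only [M]; ring

theorem sum_pow_le_pow {M : ℝ} (hM : 2 ≤ M) (K : ℕ) : ∑ k ∈ Finset.range K, M ^ k ≤ M ^ K := by
  induction K with
  | zero => simp
  | succ K ih =>
    rw [Finset.sum_range_succ, pow_succ]
    have : 0 ≤ M ^ K := by positivity
    nlinarith

/-- Truncating the Neumann series of a fixed point equation. -/
theorem eq_sum_iterate_add {E : Type*} [NormedAddCommGroup E] [NormedSpace ℂ E]
    {T : E →L[ℂ] E} {v x : E} (h : x = v + T x) (K : ℕ) :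
    x = ∑ k ∈ Finset.range K, (T ^ k) v + (T ^ K) x := by
  induction K with
  | zero => simp
  | succ K ih =>
    rw [Finset.sum_range_succ, add_assoc, pow_succ, mul_apply_eq_comp, ← map_add, ← h]
    exact ih

/-- Balancing a growing factor in the number of Neumann steps against exponential decay. -/
theorem exists_exp_bound {r : ℕ → ℝ} {α β M q s : ℝ} (hα : 0 ≤ α) (hβ : 0 ≤ β) (hM : 2 ≤ M)
    (hq : q < 1) (hq0 : 0 ≤ q) (hs : 0 < s)
    (h : ∀ n K : ℕ, r n ≤ α * M ^ K * Real.exp (-s * n) + β * q ^ K) :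
    ∃ c C₀ : ℝ, 0 < c ∧ 0 < C₀ ∧ ∀ n : ℕ, r n ≤ C₀ * Real.exp (-c * n) := by
  -- q may be 0 (when A = B in the application); q₀ has a logarithm and can be divided by.
  set q₀ := max q (1 / 2)
  have hq₀ : 0 < q₀ := lt_max_of_lt_right (by norm_num)
  have hq₁ : q₀ < 1 := max_lt hq (by norm_num)
  have hlM : 0 < Real.log M := Real.log_pos (by linarith)
  have hlq : Real.log q₀ < 0 := Real.log_neg hq₀ hq₁
  -- With K ≤ δn steps, M^K uses up at most half of the decay e^{-sn}. Rounding K down costs the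
  -- factor 1/q₀ in the second term.
  set δ := s / (2 * Real.log M)
  have hδ : 0 < δ := by positivity
  set c := min (s / 2) (δ * -Real.log q₀)
  have hc : 0 < c := lt_min (by positivity) (mul_pos hδ (by linarith))
  refine ⟨c, α + β / q₀ + 1, hc, by positivity, fun n => ?_⟩
  set K := ⌊δ * n⌋₊
  have hn : (0 : ℝ) ≤ n := n.cast_nonneg
  have hK1 : (K : ℝ) ≤ δ * n := Nat.floor_le (by positivity)
  have hK2 : δ * n < K + 1 := Nat.lt_floor_add_one _
  have e1 : M ^ K * Real.exp (-s * n) ≤ Real.exp (-c * n) := by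
    rw [← Real.exp_log (pow_pos (by linarith : 0 < M) K), Real.log_pow, ← Real.exp_add]
    apply Real.exp_le_exp.2
    have h1 : K * Real.log M ≤ s / 2 * n := by
      calc K * Real.log M ≤ δ * n * Real.log M := by gcongr
        _ = s / 2 * n := by simp only [δ]; field_simp
    have h2 : c * n ≤ s / 2 * n := by gcongr; exact min_le_left _ _
    nlinarith
  have e2 : q ^ K ≤ 1 / q₀ * Real.exp (-c * n) := by
    calc q ^ K ≤ q₀ ^ K := by gcongr; exact le_max_left _ _
      _ = Real.exp (K * Real.log q₀) := by rw [Real.exp_nat_mul, Real.exp_log hq₀]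
      _ ≤ Real.exp (-Real.log q₀ + -c * n) := by
          apply Real.exp_le_exp.2
          have h2 : c * n ≤ δ * -Real.log q₀ * n := by gcongr; exact min_le_right _ _
          nlinarith
      _ = 1 / q₀ * Real.exp (-c * n) := by
          rw [Real.exp_add, Real.exp_neg, Real.exp_log hq₀, one_div]
  calc r n ≤ α * M ^ K * Real.exp (-s * n) + β * q ^ K := h n K
    _ = α * (M ^ K * Real.exp (-s * n)) + β * q ^ K := by ring
    _ ≤ α * Real.exp (-c * n) + β * (1 / q₀ * Real.exp (-c * n)) := by gcongr
    _ = (α + β / q₀) * Real.exp (-c * n) := by ring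
    _ ≤ (α + β / q₀ + 1) * Real.exp (-c * n) :=
        mul_le_mul_of_nonneg_right (le_add_of_nonneg_right zero_le_one) (Real.exp_pos _).le

/-- A bounded sequence with some exponential decay decays exponentially with a constant
controlled by its bound, at the expense of the rate. -/
theorem exists_rate_of_bound {r : ℕ → ℝ} {R c C₀ lam : ℝ} (hR : 0 < R) (hc : 0 < c)
    (hC₀ : 0 < C₀) (hlam : 0 < lam) (hrR : ∀ n, r n ≤ R)
    (hr : ∀ n : ℕ, r n ≤ C₀ * Real.exp (-c * n)) :
    ∃ lam' : ℝ, 0 < lam' ∧ lam' < lam ∧ ∀ n : ℕ, r n ≤ 2 * R * Real.exp (-lam' * n) := by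
  -- Beyond N, half of the decay rate c absorbs C₀/R.
  set N := max (2 * Real.log (C₀ / R) / c) 0
  have hN : 0 ≤ N := le_max_right _ _
  -- The three terms serve n ≥ N, the bound e^{-λ'n} ≥ 1/2 for n ≤ N (where r n ≤ R suffices), and
  -- λ' < λ.
  set lam' := min (min (c / 2) (Real.log 2 / (N + 1))) (lam / 2)
  have hl2 : 0 < Real.log 2 := Real.log_pos (by norm_num)
  have hl' : 0 < lam' := lt_min (lt_min (by positivity) (by positivity)) (by positivity)
  refine ⟨lam', hl', (min_le_right _ _).trans_lt (by linarith), fun n => ?_⟩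
  have hn : (0 : ℝ) ≤ n := n.cast_nonneg
  rcases le_total (n : ℝ) N with hle | hge
  · have h1 : lam' * n ≤ Real.log 2 := by
      calc lam' * n ≤ Real.log 2 / (N + 1) * (N + 1) := by
            gcongr
            · exact (min_le_left _ _).trans (min_le_right _ _)
            · linarith
        _ = Real.log 2 := by field_simp
    have h2 : 1 / 2 ≤ Real.exp (-lam' * n) := by
      calc (1 / 2 : ℝ) = Real.exp (-Real.log 2) := by
            rw [Real.exp_neg, Real.exp_log (by norm_num), one_div]
        _ ≤ _ := Real.exp_le_exp.2 (by linarith)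
    calc r n ≤ R := hrR n
      _ = 2 * R * (1 / 2) := by ring
      _ ≤ _ := by gcongr
  · have h1 : Real.log (C₀ / R) ≤ c / 2 * n := by
      have := (le_max_left (2 * Real.log (C₀ / R) / c) 0).trans hge
      rw [div_le_iff₀ hc] at this
      linarith
    have h2 : lam' * n ≤ c / 2 * n := by
      gcongr
      exact (min_le_left _ _).trans (min_le_left _ _)
    calc r n ≤ C₀ * Real.exp (-c * n) := hr n
      _ = R * Real.exp (Real.log (C₀ / R) + -c * n) := by
          rw [Real.exp_add, Real.exp_log (by positivity)]
          field_simp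
      _ ≤ R * Real.exp (-lam' * n) := by
          gcongr
          linarith
      _ ≤ 2 * R * Real.exp (-lam' * n) := by
          have := Real.exp_pos (-lam' * n)
          gcongr
          linarith

/-- The finite-section error decays exponentially. -/
theorem IsDualWindow.exists_exp_bound {g γ : L2R} {a b A B : ℝ} {S : L2R →L[ℂ] L2R}
    (h : IsDualWindow g γ a b A B S) (ha : 0 < a) (hb : 0 < b) (hA : 0 < A) (hB : 0 < B)
    (hAB : A ≤ B) {s E : ℝ} (hs : 0 < s)
    (hdecay : ∀ p : ℤ × ℤ, ‖(inner ℂ g (adjointAtom g a b p) : ℂ)‖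
      ≤ E * Real.exp (-(2 * s) * (|(p.1 : ℝ)| + |(p.2 : ℝ)|)))
    (hsum : Summable fun p => ‖(inner ℂ g (adjointAtom g a b p) : ℂ)‖) :
    ∃ c C₀ : ℝ, 0 < c ∧ 0 < C₀ ∧
      ∀ n : ℕ, ‖γ - dualWindowSection g a b n‖ ≤ C₀ * Real.exp (-c * n) := by
  set t : ℝ := A / B ^ 2
  have ht : 0 < t := by positivity
  set q : ℝ := √(1 - (A / B) ^ 2)
  have hq : q < 1 := by
    rw [Real.sqrt_lt' one_pos]
    have : 0 < (A / B) ^ 2 := by positivity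
    linarith
  have hq0 : 0 ≤ q := Real.sqrt_nonneg _
  let T : L2R →L[ℂ] L2R := 1 - (t : ℂ) • S
  have hT : ∀ f, T f = f - (t : ℂ) • S f := fun f => rfl
  have hTq : ∀ f, ‖T f‖ ≤ q * ‖f‖ :=
    norm_sub_smul_apply_le hA hB hAB h.lower_bound h.norm_apply_le
  have hTK : ∀ (K : ℕ) f, ‖(T ^ K) f‖ ≤ q ^ K * ‖f‖ := by
    intro K
    induction K with
    | zero => simp
    | succ K ih =>
      intro f
      rw [pow_succ, mul_apply_eq_comp, pow_succ, mul_assoc]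
      exact (ih _).trans (by gcongr; exact hTq f)
  -- This is Sγ = g in fixed-point form, ready for the truncated Neumann series.
  have hfix : γ = (t : ℂ) • g + T γ := by
    rw [hT, h.apply_eq, add_sub_cancel]
  set r : ℤ × ℤ → ℝ := fun p => (a * b)⁻¹ * ‖(inner ℂ g (adjointAtom g a b p) : ℂ)‖
  have hr : Summable fun p => r p * expWeight s p := by
    refine ((summable_mul_expWeight hs hdecay).mul_left (a * b)⁻¹).congr fun p => ?_
    simp only [r]; ring
  -- One more than the base supplied by `norm_iterate_le`, so that M ≥ 2 and `sum_pow_le_pow`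
  -- applies.
  set M := 2 + t * ∑' p, r p * expWeight s p
  have hW : 0 ≤ ∑' p, r p * expWeight s p :=
    tsum_nonneg fun p => mul_nonneg (by positivity) (expWeight_pos s p).le
  have hM : 2 ≤ M := le_add_of_nonneg_right (by positivity)
  refine Gabor.exists_exp_bound (α := t * ‖g‖) (β := ‖γ‖) (M := M) (q := q) (s := s)
    (by positivity) (norm_nonneg _) hM hq hq0 hs fun n K => ?_
  set Q : L2R →L[ℂ] L2R := (sectionSpan g a b n)ᗮ.starProjection
  have hQγ : Q γ = γ - dualWindowSection g a b n := by
    rw [← h.starProjection_eq ha hb n]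
    exact Submodule.starProjection_orthogonal_val γ
  have hQ1 : ∀ f, ‖Q f‖ ≤ ‖f‖ := fun f => Submodule.norm_starProjection_apply_le _ f
  set ε := ‖g‖ * Real.exp (-s * n)
  have hε : 0 ≤ ε := by positivity
  -- Q annihilates the atoms of the section; outside it |k| + |l| ≥ n, so the weight compensates
  -- e^{-sn}.
  have hQe : ∀ p, ‖Q (adjointAtom g a b p)‖ ≤ expWeight s p * ε := by
    intro p
    by_cases hp : p ∈ sectionIndex n
    · have : Q (adjointAtom g a b p) = 0 := by
        rw [Submodule.starProjection_apply_eq_zero_iff]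
        exact Submodule.le_orthogonal_orthogonal _ (Submodule.subset_span ⟨⟨p, hp⟩, rfl⟩)
      rw [this, norm_zero]
      exact mul_nonneg (expWeight_pos s p).le hε
    · have hnp : (n : ℝ) ≤ |(p.1 : ℝ)| + |(p.2 : ℝ)| := by
        have h1 : (n : ℤ) ≤ |p.1| + |p.2| := by
          by_contra hlt
          apply hp
          have h1 := abs_nonneg p.1
          have h2 := abs_nonneg p.2
          simp only [sectionIndex, Finset.mem_product, Finset.mem_Icc, ← abs_le]
          omega
        exact_mod_cast h1
      calc ‖Q (adjointAtom g a b p)‖ ≤ ‖g‖ := (hQ1 _).trans (norm_adjointAtom _ _ _ _).le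
        _ = ‖g‖ * Real.exp (s * n + -s * n) := by simp
        _ = Real.exp (s * n) * ε := by rw [Real.exp_add]; ring
        _ ≤ expWeight s p * ε := by
            unfold expWeight
            gcongr
  have key : ∀ k, ‖Q ((T ^ k) g)‖ ≤ M ^ k * ε := by
    intro k
    have h1 := norm_iterate_le ht.le hT hs.le hr
      (exists_hasSum_frameOp_adjointAtom ha hb h.hasSum_apply hsum) hQe hε k (0, 0)
    rw [adjointAtom_zero] at h1
    refine h1.trans ?_
    have : expWeight s (0, 0) = 1 := by simp [expWeight]
    rw [this, one_mul]
    gcongr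
    linarith
  have hQK : Q γ = ∑ k ∈ Finset.range K, Q ((T ^ k) ((t : ℂ) • g)) + Q ((T ^ K) γ) := by
    rw [← map_sum, ← map_add, ← eq_sum_iterate_add hfix K]
  rw [← hQγ, hQK]
  calc ‖∑ k ∈ Finset.range K, Q ((T ^ k) ((t : ℂ) • g)) + Q ((T ^ K) γ)‖
      ≤ ∑ k ∈ Finset.range K, t * (M ^ k * ε) + q ^ K * ‖γ‖ := by
        refine norm_add_le_of_le ?_ ((hQ1 _).trans (hTK K γ))
        refine norm_sum_le_of_le _ fun k _ => ?_
        rw [map_smul, map_smul, norm_smul, Complex.norm_real, Real.norm_of_nonneg ht.le]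
        gcongr
        exact key k
    _ = t * ε * ∑ k ∈ Finset.range K, M ^ k + q ^ K * ‖γ‖ := by
        rw [Finset.mul_sum]
        congr 1
        exact Finset.sum_congr rfl fun k _ => by ring
    _ ≤ t * ε * M ^ K + q ^ K * ‖γ‖ := by
        gcongr
        exact sum_pow_le_pow hM K
    _ = t * ‖g‖ * M ^ K * Real.exp (-s * n) + ‖γ‖ * q ^ K := by ring

/-- The finite-section error never exceeds the norm of the dual window. -/
theorem IsDualWindow.norm_sub_dualWindowSection_le {g γ : L2R} {a b A B : ℝ} {S : L2R →L[ℂ] L2R}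
    (h : IsDualWindow g γ a b A B S) (ha : 0 < a) (hb : 0 < b) (n : ℕ) :
    ‖γ - dualWindowSection g a b n‖ ≤ ‖γ‖ := by
  rw [← h.starProjection_eq ha hb n, ← Submodule.starProjection_orthogonal_val]
  exact Submodule.norm_starProjection_apply_le _ γ

end Gabor

theorem mainTheorem4 :
    ∃ K : ℝ → ℝ → ℝ → ℝ,
      ∀ (g : L2R) (a b A B lam C D : ℝ),
        0 < a → 0 < b → 0 < lam → 0 < C → 0 < D →
        IsGaborFrame g a b A B →
        (∀ᵐ t : ℝ, ‖g t‖ ≤ C * Real.exp (-lam * |t|)) →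
        (∀ ω : ℝ, ‖𝓕 (fun t : ℝ => g t) ω‖ ≤ D * Real.exp (-lam * |ω|)) →
        ∃ lam' : ℝ, 0 < lam' ∧ lam' < lam ∧
          ∀ n : ℕ, ‖gaborDualWindow g a b - dualWindowSection g a b n‖ ≤
            K A B lam' * Real.exp (-lam' * n) := by
  -- Twice the bound on ‖γ‖; the influence of g, a, b, C and D goes into the rate λ'.
  refine ⟨fun A _ _ => 2 * (1 / √A), ?_⟩
  intro g a b A B lam C D ha hb hlam hC hD hframe hg hg'
  obtain ⟨s, hs, E, hE, hdecay⟩ := Gabor.exists_exp_decay_inner_adjointAtom ha hb hlam hg hg'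
  have hsum : Summable fun p => ‖(inner ℂ g (adjointAtom g a b p) : ℂ)‖ := by
    refine Summable.of_nonneg_of_le (fun _ => norm_nonneg _) (fun p => ?_)
      (Gabor.summable_mul_expWeight hs hdecay)
    refine le_mul_of_one_le_right (norm_nonneg _) (Real.one_le_exp ?_)
    positivity
  obtain ⟨S, hS⟩ := hframe.exists_isDualWindow ha hb hsum
  obtain ⟨c, C₀, hc, hC₀, hbound⟩ :=
    hS.exists_exp_bound ha hb hframe.1 hframe.2.1 hframe.le hs hdecay hsum
  have hA : 0 < √A := Real.sqrt_pos.2 hframe.1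
  exact Gabor.exists_rate_of_bound (by positivity) hc hC₀ hlam
    (fun n => (hS.norm_sub_dualWindowSection_le ha hb n).trans (hS.norm_le hframe.1 ha hb)) hbound
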